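/- Let $\mathbb{T}^2=\mathbb{R}^2/\mathbb{Z}^2$ and, for an integer $k\ge 1$, let $T_k:\mathbb{T}^2\to\mathbb{T}^2$ be the map that multiplies both coordinates by $k$ modulo $1$. For $(x,y)\in\mathbb{T}^2$ put $$\mathrm{Orb}_{2,3,5}(x,y)=\{T_2^{a}T_3^{b}T_5^{c}(x,y) : a,b,c\in\mathbb{Z},\ a,b,c\ge 0\}.$$ Choose real numbers representing the coordinates of the point, again denoted $x,y$. They are called rationally related if there are integers $m,n,k$ with $\gcd(m,n,k)=1$ and $mx+ny=k$. (Neither this property nor the irrationality of $x$ or of $y$ depends on the choice of representatives modulo $1$.) Theorem. Let $(x,y)\in\mathbb{T}^2$. If $x$ and $y$ are irrational and not rationally related, then $\mathrm{Orb}_{2,3,5}(x,y)$ is dense in $\mathbb{T}^2$. Conversely, if $\mathrm{Orb}_{2,3,5}(x,y)$ is dense in $\mathbb{T}^2$, then $x$ and $y$ are irrational and not rationally related. -/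

import Mathlib

/-- The two-dimensional torus `𝕋² = (ℝ / ℤ)²`, with the product topology. -/
abbrev TorusTwo : Type := UnitAddCircle × UnitAddCircle

/-- The point of `𝕋²` represented by the pair of real numbers `(x, y)`. -/
def torusPoint (x y : ℝ) : TorusTwo := ((x : UnitAddCircle), (y : UnitAddCircle))

/-- The map `T_k : 𝕋² → 𝕋²`, multiplication of both coordinates by `k`. -/
def timesMap (k : ℕ) (p : TorusTwo) : TorusTwo := (k • p.1, k • p.2)

/-- The orbit of `p` under the semigroup generated by `T_2`, `T_3` and `T_5`. -/
def orbit235 (p : TorusTwo) : Set TorusTwo :=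
  {q | ∃ a b c : ℕ, q = (timesMap 2)^[a] ((timesMap 3)^[b] ((timesMap 5)^[c] p))}

/-- `x` and `y` are rationally related: `m x + n y = k` for some integers `m, n, k` without a
common factor (in particular not all zero). This depends only on `x` and `y` modulo `1`. -/
def RationallyRelated (x y : ℝ) : Prop :=
  ∃ m n k : ℤ, Int.gcd (Int.gcd m n : ℤ) k = 1 ∧ (m : ℝ) * x + (n : ℝ) * y = (k : ℝ)

/-! The substance is that an orbit closure `X` fills the torus when the coordinates `u, v` are
independent over the integers. The second projection of `X` is a closed set invariant under `2` and
`3`, so it contains a torsion point, by Furstenberg's argument (`exists_torsion_mem_of_invariant`).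
Passing to a multiple of `(u, v)` is harmless by Baire (`dense_orbit235_of_nsmul`), so either `X`
contains `(u', 0)` with `u'` of infinite order, or it contains the origin. At the origin, the orbit
points have a limiting slope and the semigroup, whose ratios of neighbours tend to `1`, stretches
them along a whole ray. That ray, or its image after a shear if the slope is rational, again
supplies a point `(u', 0)`.

At `(u', 0)` the second coordinate is lifted to a small real scale, and `dense_scale` shows that
further multiplications fill the half-cylinder. Its proof studies accumulation points together with
their histories under halving, a closed subset of (dyadic solenoid) × ℝ. If a history of positive
scale lies on a real leaf up to torsion, multiples of `x n` are within `O`(scale) of integers.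
Stripping factors `2`, `3`, `5` must then meet a fraction with prime power denominator, which the
other two primes spread over the circle: otherwise a fixed multiple of `x n` would tend to `0`. If
there is no such history, multiplication by `3 ^ b * 5 ^ c / 2 ^ a ≈ 1` keeps the scale and realises
every translation between two histories. Translations of finite order can be iterated and fill the
fibres.

Conversely, a rational relation confines the orbit to a proper closed subgroup, and a rational
coordinate is already such a relation. -/

open Filter Topology

/-! ### Small multiplicative gaps in two-generator semigroups. -/

/-- Non-negative integer combinations of two incommensurable positive reals are eventually
`ε`-dense on the half-line. -/
theorem exists_nat_combination_near {α β ε : ℝ} (hβ : 0 < β)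
    (h : Irrational (α / β)) (hε : 0 < ε) :
    ∃ t₀ : ℝ, ∀ t ≥ t₀, ∃ i j : ℕ, t ≤ i * α + j * β ∧ i * α + j * β ≤ t + ε := by
  obtain ⟨γ, hγ, hγS⟩ := (dense_addSubgroupClosure_pair_iff.mpr h).exists_mem_open isOpen_Ioo
    (Set.nonempty_Ioo.mpr hε)
  obtain ⟨m, n, hmn⟩ := AddSubgroup.mem_closure_pair.mp hγ
  simp only [zsmul_eq_mul] at hmn
  obtain ⟨hγ0, hγε⟩ := hγS
  set k₀ := ⌈β / γ⌉₊
  -- The remainder `f` is below `β`, so at most `k₀` steps of size `γ` are needed. Starting from `P`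
  -- copies of `α + β` keeps both coefficients non-negative during these steps.
  set P : ℕ := k₀ * (m.natAbs + n.natAbs)
  refine ⟨P * (α + β), fun t ht => ?_⟩
  set s := t - P * (α + β) with hs
  have hs0 : 0 ≤ s := by linarith
  set l := ⌊s / β⌋₊
  have hl : (l : ℝ) * β ≤ s := by
    have := Nat.floor_le (div_nonneg hs0 hβ.le)
    rwa [le_div_iff₀ hβ] at this
  have hl' : s < (l + 1) * β := by
    have := Nat.lt_floor_add_one (s / β)
    rwa [div_lt_iff₀ hβ] at this
  set f := s - l * β with hf
  have hf0 : 0 ≤ f := by linarith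
  set k := ⌈f / γ⌉₊
  have hk1 : f ≤ k * γ := by
    have := Nat.le_ceil (f / γ)
    rwa [div_le_iff₀ hγ0] at this
  have hk2 : k * γ ≤ f + γ := by
    have := (Nat.ceil_lt_add_one (div_nonneg hf0 hγ0.le)).le
    have := mul_le_mul_of_nonneg_right this hγ0.le
    rwa [add_mul, div_mul_cancel₀ _ hγ0.ne', one_mul] at this
  have hkk : k ≤ k₀ := Nat.ceil_mono (div_le_div_of_nonneg_right (by linarith) hγ0.le)
  have key : ∀ z : ℤ, z.natAbs ≤ m.natAbs + n.natAbs → 0 ≤ (P : ℤ) + k * z := by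
    intro z hz
    have h1 : k * z.natAbs ≤ P := Nat.mul_le_mul hkk hz
    have h2 : -(z.natAbs : ℤ) ≤ z := by omega
    have h3 : (k : ℤ) * (-(z.natAbs : ℤ)) ≤ k * z := mul_le_mul_of_nonneg_left h2 (by positivity)
    have h4 : (k : ℤ) * z.natAbs ≤ P := by exact_mod_cast h1
    linarith
  obtain ⟨i, hi⟩ := Int.eq_ofNat_of_zero_le (key m (by omega))
  obtain ⟨j, hj⟩ := Int.eq_ofNat_of_zero_le (key n (by omega))
  have hi' : (i : ℝ) = P + k * m := by exact_mod_cast hi.symm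
  have hj' : (j : ℝ) = P + k * n := by exact_mod_cast hj.symm
  have e : (i : ℝ) * α + (j + l : ℕ) * β = t - f + k * γ := by
    push_cast
    rw [hi', hj', ← hmn, hf, hs]; ring
  exact ⟨i, j + l, by rw [e]; linarith, by rw [e]; linarith⟩

theorem irrational_log_div_log {g h : ℕ} (hg : 2 ≤ g) (hh : 2 ≤ h) (hgh : g.Coprime h) :
    Irrational (Real.log g / Real.log h) := by
  have lg : 0 < Real.log g := Real.log_pos (by exact_mod_cast hg)
  have lh : 0 < Real.log h := Real.log_pos (by exact_mod_cast hh)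
  rintro ⟨r, hr⟩
  have hr0 : 0 < r := by
    have : (0 : ℝ) < r := hr ▸ div_pos lg lh
    exact_mod_cast this
  obtain ⟨n, hn⟩ := Int.eq_ofNat_of_zero_le (Rat.num_pos.mpr hr0).le
  have hd : (r : ℝ) = n / r.den := by
    have := Rat.cast_def (K := ℝ) r
    rw [hn] at this
    simpa using this
  have hden : (r.den : ℝ) ≠ 0 := by exact_mod_cast r.den_nz
  have e : (r.den : ℝ) * Real.log g = n * Real.log h := by
    rw [hd] at hr
    field_simp at hr
    linarith
  have e2 : ((g ^ r.den : ℕ) : ℝ) = ((h ^ n : ℕ) : ℝ) := by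
    apply Real.log_injOn_pos (Set.mem_Ioi.mpr (by positivity)) (Set.mem_Ioi.mpr (by positivity))
    push_cast
    rw [Real.log_pow, Real.log_pow, e]
  have e3 : g ^ r.den = h ^ n := by exact_mod_cast e2
  have : (g ^ r.den).Coprime (h ^ n) := hgh.pow _ _
  rw [← e3, Nat.coprime_self] at this
  have := Nat.one_lt_pow r.den_nz (by omega : 1 < g)
  omega

/-- The semigroup generated by two coprime integers is non-lacunary, even with exponents
restricted to residue classes. -/
theorem exists_pow_mul_pow_near {g h : ℕ} (hg : 2 ≤ g) (hh : 2 ≤ h) (hgh : g.Coprime h)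
    {M : ℕ} (hM : 0 < M) {ε : ℝ} (hε : 0 < ε) :
    ∃ T₀ : ℝ, 1 ≤ T₀ ∧ ∀ T ≥ T₀, ∀ b₀ : ℕ, ∃ b c : ℕ, b ≡ b₀ [MOD M] ∧ M ∣ c ∧
      T ≤ (g : ℝ) ^ b * (h : ℝ) ^ c ∧ (g : ℝ) ^ b * (h : ℝ) ^ c ≤ T * (1 + ε) := by
  have lg : 0 < Real.log g := Real.log_pos (by exact_mod_cast hg)
  have lh : 0 < Real.log h := Real.log_pos (by exact_mod_cast hh)
  have hM' : (0 : ℝ) < M := by exact_mod_cast hM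
  have hirr : Irrational ((M * Real.log g) / (M * Real.log h)) := by
    rw [mul_div_mul_left _ _ hM'.ne']
    exact irrational_log_div_log hg hh hgh
  obtain ⟨t₀, ht₀⟩ := exists_nat_combination_near (mul_pos hM' lh) hirr
    (Real.log_pos (by linarith : 1 < 1 + ε))
  -- The summand `M * log g` leaves room for the residual factor `g ^ (b₀ % M)`.
  refine ⟨max 1 (Real.exp (t₀ + M * Real.log g)), le_max_left _ _, fun T hT b₀ => ?_⟩
  have hT1 : 1 ≤ T := (le_max_left _ _).trans hT
  have hT0 : 0 < T := by linarith
  have hlog : t₀ + M * Real.log g ≤ Real.log T :=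
    (Real.le_log_iff_exp_le hT0).mpr ((le_max_right _ _).trans hT)
  have hb : ((b₀ % M : ℕ) : ℝ) ≤ M := by exact_mod_cast (Nat.mod_lt _ hM).le
  obtain ⟨i, j, h1, h2⟩ := ht₀ (Real.log T - (b₀ % M : ℕ) * Real.log g) (by nlinarith)
  have hgp : (0 : ℝ) < g := by positivity
  have hhp : (0 : ℝ) < h := by positivity
  have e : Real.log ((g : ℝ) ^ (b₀ % M + M * i) * (h : ℝ) ^ (M * j)) =
      (b₀ % M : ℕ) * Real.log g + (i * (M * Real.log g) + j * (M * Real.log h)) := by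
    rw [Real.log_mul (by positivity) (by positivity), Real.log_pow, Real.log_pow]
    push_cast; ring
  refine ⟨b₀ % M + M * i, M * j, ?_, ⟨j, rfl⟩, ?_, ?_⟩
  · simp [Nat.ModEq]
  · rw [← Real.log_le_log_iff hT0 (by positivity), e]; linarith
  · rw [← Real.log_le_log_iff (by positivity) (by positivity), e,
      Real.log_mul hT0.ne' (by positivity)]
    linarith

/-! ### Powers modulo prime powers and the fractions `u / p ^ L`. -/

theorem exists_one_add_pow_eq (x : ℤ) (j : ℕ) : ∃ r : ℤ, (1 + x) ^ j = 1 + j * x + x ^ 2 * r := by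
  induction j with
  | zero => exact ⟨0, by simp⟩
  | succ j ih =>
    obtain ⟨r, hr⟩ := ih
    exact ⟨r + j + x * r, by rw [pow_succ, hr]; push_cast; ring⟩

theorem exists_nat_modEq_mul {p : ℕ} (hp : p.Prime) {w : ℤ} (hw : ¬ (p : ℤ) ∣ w) (t : ℤ) (L : ℕ) :
    ∃ j : ℕ, ((p : ℤ) ^ L) ∣ t + j * w := by
  have hcop : IsCoprime w ((p : ℤ) ^ L) :=
    (((Nat.prime_iff_prime_int.mp hp).coprime_iff_not_dvd.mpr hw).symm).pow_right
  obtain ⟨a, b, hab⟩ := hcop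
  have hpos : (0 : ℤ) < (p : ℤ) ^ L := by have := hp.pos; positivity
  obtain ⟨j, hj⟩ := Int.eq_ofNat_of_zero_le (Int.emod_nonneg (-t * a) hpos.ne')
  refine ⟨j, ?_⟩
  have hj' : (j : ℤ) = (-t * a) % (p : ℤ) ^ L := hj.symm
  have h2 := Int.emod_add_mul_ediv (-t * a) ((p : ℤ) ^ L)
  rw [← hj'] at h2
  refine ⟨b * t - w * (-t * a / (p : ℤ) ^ L), ?_⟩
  linear_combination w * h2 - t * hab

/-- Powers of `1 + p ^ h * w`, with `p ∤ w`, exhaust the residues `≡ 1` modulo `p ^ h`. -/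
theorem exists_pow_congr {p : ℕ} (hp : p.Prime) {h : ℕ} (hh : 2 ≤ h) {w : ℤ}
    (hw : ¬ (p : ℤ) ∣ w) (c : ℤ) (d : ℕ) :
    ∃ n : ℕ, (p : ℤ) ^ (h + d) ∣ (1 + (p : ℤ) ^ h * w) ^ n - (1 + (p : ℤ) ^ h * c) := by
  induction d with
  | zero => exact ⟨0, ⟨-c, by simp⟩⟩
  | succ d ih =>
    obtain ⟨n, t, ht⟩ := ih
    have hp2 := hp.two_le
    obtain ⟨y, hy⟩ := ZMod.exists_one_add_mul_pow_prime_pow_eq (R := ℤ) (u := (p : ℤ) ^ h)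
      (v := (p : ℤ)) hp (dvd_pow_self _ (by omega))
      (by
        rw [← pow_succ', ← pow_succ, ← pow_mul]
        exact pow_dvd_pow _ (by nlinarith)) w d
    set w' := w + p * y with hw'
    have hw'' : ¬ (p : ℤ) ∣ w' := by
      rw [hw']
      rwa [dvd_add_left (dvd_mul_right _ _)]
    -- To first order, multiplying by the `j`-th power of `1 + p ^ (h + d) * w'` adds `j * w'` to
    -- the digit `t`, so this `j` cancels it modulo `p`.
    obtain ⟨j, s, hs⟩ := exists_nat_modEq_mul hp hw'' t 1
    obtain ⟨r, hr⟩ := exists_one_add_pow_eq ((p : ℤ) ^ d * (p : ℤ) ^ h * w') j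
    refine ⟨n + p ^ d * j, ?_⟩
    obtain ⟨h', rfl⟩ : ∃ h', h = h' + 2 := ⟨h - 2, by omega⟩
    rw [pow_add (1 + (p : ℤ) ^ (h' + 2) * w) n, pow_mul _ (p ^ d) j, hy, hr]
    have e1 : (1 + (p : ℤ) ^ (h' + 2) * w) ^ n =
        1 + (p : ℤ) ^ (h' + 2) * c + (p : ℤ) ^ (h' + 2 + d) * t := by linarith
    rw [e1]
    set q := (p : ℤ) ^ (h' + 2 + d + 1) with hq
    have hqe : q = (p : ℤ) ^ h' * p ^ d * p ^ 3 := by rw [hq]; ring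
    refine ⟨s + (p : ℤ) ^ (h' + 1) * (c + (p : ℤ) ^ d * t) * j * w' +
      (1 + (p : ℤ) ^ (h' + 2) * c + (p : ℤ) ^ (h' + 2 + d) * t) *
        ((p : ℤ) ^ (d + h' + 1) * w' ^ 2 * r), ?_⟩
    have : (p : ℤ) ^ (h' + 2 + (d + 1)) = q := by rw [hq]; ring_nf
    rw [this, hqe]
    linear_combination ((p : ℤ) ^ (h' + 2 + d)) * hs

/-- Euler's theorem modulo `p ^ 2`, followed by extraction of the exact power of `p`. The bound `2 ≤
h` yields `h + 2 ≤ h * p`, which the lifting of powers needs even at `p = 2`. -/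
theorem exists_pow_eq_one_add {p g K : ℕ} (hp : p.Prime) (hg : 2 ≤ g) (hgp : g.Coprime p)
    (hK : 0 < K) :
    ∃ e h : ℕ, ∃ w : ℤ, K ∣ e ∧ 2 ≤ h ∧ ¬ (p : ℤ) ∣ w ∧ (g : ℤ) ^ e = 1 + (p : ℤ) ^ h * w := by
  set e := K * Nat.totient (p ^ 2)
  have he : e ≠ 0 := Nat.mul_ne_zero hK.ne' (Nat.totient_pos.mpr (pow_pos hp.pos 2)).ne'
  have h1 : 1 < g ^ e := Nat.one_lt_pow he (by omega)
  have hmod : g ^ e ≡ 1 [MOD p ^ 2] := by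
    have := (Nat.ModEq.pow_totient (hgp.pow_right 2)).pow K
    rwa [one_pow, ← pow_mul, mul_comm] at this
  have hdvd : p ^ 2 ∣ g ^ e - 1 := (Nat.modEq_iff_dvd' h1.le).mp hmod.symm
  obtain ⟨h, w, hw, hhw⟩ := Nat.exists_eq_pow_mul_and_not_dvd (n := g ^ e - 1) (by omega) p
    hp.ne_one
  refine ⟨e, h, w, ⟨_, rfl⟩, ?_, by exact_mod_cast hw, ?_⟩
  · by_contra hlt
    have h2 : p ^ (h + 1) ∣ p ^ h * w := by
      rw [← hhw]
      exact (pow_dvd_pow p (by omega)).trans hdvd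
    rw [pow_succ] at h2
    exact hw (Nat.dvd_of_mul_dvd_mul_left (pow_pos hp.pos h) h2)
  · have : g ^ e = 1 + p ^ h * w := by omega
    exact_mod_cast this

theorem norm_coe_le_abs (t : ℝ) : ‖(t : UnitAddCircle)‖ ≤ |t| := by
  rw [UnitAddCircle.norm_eq]
  simpa using round_le t 0

theorem coe_intCast_eq_zero (n : ℤ) : (((n : ℝ) : ℝ) : UnitAddCircle) = 0 :=
  (AddCircle.coe_eq_zero_iff 1).mpr ⟨n, by simp⟩

/-- Multiplying fractions with denominator a large power of `p` by powers of `g` gives a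
`δ`-dense set of the circle. -/
theorem exists_pow_smul_fraction_near {p g K : ℕ} (hp : p.Prime) (hg : 2 ≤ g)
    (hgp : g.Coprime p) (hK : 0 < K) {δ : ℝ} (hδ : 0 < δ) :
    ∃ L₀ : ℕ, ∀ L ≥ L₀, ∀ u : ℤ, ¬ (p : ℤ) ∣ u → ∀ v : UnitAddCircle, ∃ b : ℕ, K ∣ b ∧
      ‖(((g : ℝ) ^ b * (u / (p : ℝ) ^ L) : ℝ) : UnitAddCircle) - v‖ < δ := by
  obtain ⟨e, h, w, hKe, hh, hw, hge⟩ := exists_pow_eq_one_add hp hg hgp hK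
  have hp1 : (1 : ℝ) < p := by exact_mod_cast hp.one_lt
  obtain ⟨d₀, hd₀⟩ := exists_pow_lt_of_lt_one hδ (inv_lt_one_of_one_lt₀ hp1)
  refine ⟨h + d₀, fun L hL u hu v => ?_⟩
  obtain ⟨θ, rfl⟩ := QuotientAddGroup.mk_surjective v
  obtain ⟨d, rfl⟩ : ∃ d, L = h + d := ⟨L - h, by omega⟩
  have hpp : (0 : ℝ) < p := by linarith
  -- Among numerators congruent to `u` modulo `p ^ h`, `u + p ^ h * E` is the last one not above `θ
  -- * p ^ (h + d)`; the error is at most `p ^ (-d)`. The next line solves `c * u ≡ E`, making `1 +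
  -- p ^ h * c` the required multiplier.
  set E : ℤ := ⌊(θ * (p : ℝ) ^ (h + d) - u) / (p : ℝ) ^ h⌋ with hE
  obtain ⟨c, k, hc⟩ := exists_nat_modEq_mul hp hu (-E) (h + d)
  obtain ⟨n, l, hn⟩ := exists_pow_congr hp hh hw c d
  refine ⟨e * n, hKe.mul_right n, ?_⟩
  have hz : (g : ℤ) ^ (e * n) * u = u + (p : ℤ) ^ h * E +
      (p : ℤ) ^ (h + d) * ((p : ℤ) ^ h * k + l * u) := by
    rw [pow_mul, hge]
    linear_combination u * hn + (p : ℤ) ^ h * hc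
  have hr : (g : ℝ) ^ (e * n) * u = u + (p : ℝ) ^ h * E +
      (p : ℝ) ^ (h + d) * (((p : ℤ) ^ h * k + l * u : ℤ) : ℝ) := by exact_mod_cast hz
  have hP : (0 : ℝ) < (p : ℝ) ^ (h + d) := by positivity
  have e1 : (g : ℝ) ^ (e * n) * (u / (p : ℝ) ^ (h + d)) =
      (u + (p : ℝ) ^ h * E) / (p : ℝ) ^ (h + d) + (((p : ℤ) ^ h * k + l * u : ℤ) : ℝ) := by
    rw [← mul_div_assoc, hr, add_div, mul_div_cancel_left₀ _ hP.ne']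
  have e2 : (((g : ℝ) ^ (e * n) * (u / (p : ℝ) ^ (h + d)) : ℝ) : UnitAddCircle) =
      (((u + (p : ℝ) ^ h * E) / (p : ℝ) ^ (h + d) : ℝ) : UnitAddCircle) := by
    rw [e1, AddCircle.coe_add, add_eq_left, coe_intCast_eq_zero]
  rw [e2]
  change ‖(((u + (p : ℝ) ^ h * E) / (p : ℝ) ^ (h + d) : ℝ) : UnitAddCircle) -
    (θ : UnitAddCircle)‖ < δ
  rw [← AddCircle.coe_sub]
  refine (norm_coe_le_abs _).trans_lt (lt_of_le_of_lt ?_ hd₀)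
  have hph : (0 : ℝ) < (p : ℝ) ^ h := by positivity
  have f1 : (E : ℝ) * (p : ℝ) ^ h ≤ θ * (p : ℝ) ^ (h + d) - u := by
    rw [← le_div_iff₀ hph]; exact Int.floor_le _
  have f2 : θ * (p : ℝ) ^ (h + d) - u < (E + 1) * (p : ℝ) ^ h := by
    rw [← div_lt_iff₀ hph]; exact Int.lt_floor_add_one _
  have e3 : (u + (p : ℝ) ^ h * E) / (p : ℝ) ^ (h + d) - θ =
      (u + (p : ℝ) ^ h * E - θ * (p : ℝ) ^ (h + d)) / (p : ℝ) ^ (h + d) := by field_simp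
  rw [e3, abs_div, abs_of_pos hP, div_le_iff₀ hP]
  have : (p : ℝ)⁻¹ ^ d₀ * (p : ℝ) ^ (h + d) ≥ (p : ℝ) ^ h := by
    rw [pow_add, mul_left_comm]
    refine le_mul_of_one_le_right hph.le ?_
    rw [inv_pow, inv_mul_eq_div, one_le_div (by positivity)]
    exact pow_le_pow_right₀ hp1.le (by omega)
  refine le_trans ?_ this
  rw [abs_le]
  constructor <;> linarith

/-- The two preceding facts combined: the multiplier can be placed in any large window. -/
theorem exists_pow_mul_pow_smul_fraction_near {p g h K : ℕ} (hp : p.Prime) (hg : 2 ≤ g)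
    (hh : 2 ≤ h) (hgh : g.Coprime h) (hgp : g.Coprime p) (hhp : h.Coprime p) (hK : 0 < K)
    {δ : ℝ} (hδ : 0 < δ) :
    ∃ L₀ : ℕ, ∀ L₁ : ℕ, ∃ T₀ : ℝ, 1 ≤ T₀ ∧ ∀ L ≥ L₀, L ≤ L₁ → ∀ u : ℤ, ¬ (p : ℤ) ∣ u →
      ∀ v : UnitAddCircle, ∀ T ≥ T₀, ∃ b c : ℕ, K ∣ b ∧ K ∣ c ∧
        T ≤ (g : ℝ) ^ b * (h : ℝ) ^ c ∧ (g : ℝ) ^ b * (h : ℝ) ^ c ≤ T * (1 + δ) ∧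
        ‖(((g : ℝ) ^ b * (h : ℝ) ^ c * (u / (p : ℝ) ^ L) : ℝ) : UnitAddCircle) - v‖ < δ := by
  obtain ⟨L₀, hL₀⟩ := exists_pow_smul_fraction_near hp hg hgp hK hδ
  refine ⟨L₀, fun L₁ => ?_⟩
  have hφ : 0 < Nat.totient (p ^ L₁) := Nat.totient_pos.mpr (pow_pos hp.pos _)
  -- Fixing exponents modulo `φ (p ^ L₁)` leaves the action on all fractions with denominator `p ^
  -- L`, `L ≤ L₁`, unchanged; this frees the size of the multiplier.
  obtain ⟨T₀, hT₀, hT⟩ := exists_pow_mul_pow_near hg hh hgh (Nat.mul_pos hK hφ) hδ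
  refine ⟨T₀, hT₀, fun L hL hL' u hu v T hTT => ?_⟩
  obtain ⟨b₀, hb₀, hv⟩ := hL₀ L hL u hu v
  obtain ⟨b, c, hb, hc, h1, h2⟩ := hT T hTT b₀
  refine ⟨b, c, ?_, (dvd_mul_right _ _).trans hc, h1, h2, ?_⟩
  · exact ((hb.of_dvd (dvd_mul_right _ _)).dvd_iff dvd_rfl).mpr hb₀
  · have key : ∀ {x : ℕ}, x.Coprime p → ∀ {m n : ℕ},
        m ≡ n [MOD K * Nat.totient (p ^ L₁)] → x ^ m ≡ x ^ n [MOD p ^ L₁] := by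
      have aux : ∀ {x : ℕ}, x.Coprime p → ∀ m : ℕ,
          x ^ m ≡ x ^ (m % (K * Nat.totient (p ^ L₁))) [MOD p ^ L₁] := by
        intro x hx m
        conv_lhs => rw [← Nat.mod_add_div m (K * Nat.totient (p ^ L₁)), pow_add]
        have : x ^ (K * Nat.totient (p ^ L₁) * (m / (K * Nat.totient (p ^ L₁)))) ≡ 1
            [MOD p ^ L₁] := by
          have := (Nat.ModEq.pow_totient (hx.pow_right L₁)).pow
            (K * (m / (K * Nat.totient (p ^ L₁))))
          rw [one_pow, ← pow_mul] at this
          convert this using 2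
          ring
        simpa using (Nat.ModEq.refl (x ^ (m % (K * Nat.totient (p ^ L₁))))).mul this
      intro x hx m n hmn
      refine (aux hx m).trans ?_
      rw [hmn]
      exact (aux hx n).symm
    have hcc : h ^ c ≡ 1 [MOD p ^ L₁] := by
      simpa using key hhp ((Nat.modEq_zero_iff_dvd).mpr hc)
    have hmod : g ^ b * h ^ c ≡ g ^ b₀ [MOD p ^ L] := by
      simpa using ((key hgp hb).mul hcc).of_dvd (pow_dvd_pow p hL')
    obtain ⟨k, hk⟩ := (Nat.modEq_iff_dvd.mp hmod.symm)
    have hk' : (g : ℝ) ^ b * (h : ℝ) ^ c - (g : ℝ) ^ b₀ = (p : ℝ) ^ L * k := by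
      push_cast at hk; exact_mod_cast hk
    have hP : (p : ℝ) ^ L ≠ 0 := by have := hp.pos; positivity
    have e1 : (g : ℝ) ^ b * (h : ℝ) ^ c * (u / (p : ℝ) ^ L) =
        (g : ℝ) ^ b₀ * (u / (p : ℝ) ^ L) + ((k * u : ℤ) : ℝ) := by
      rw [eq_add_of_sub_eq hk']
      push_cast
      field_simp
      ring
    have e2 : (((g : ℝ) ^ b * (h : ℝ) ^ c * (u / (p : ℝ) ^ L) : ℝ) : UnitAddCircle) =
        (((g : ℝ) ^ b₀ * (u / (p : ℝ) ^ L) : ℝ) : UnitAddCircle) := by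
      rw [e1, AddCircle.coe_add, add_eq_left, coe_intCast_eq_zero]
    rwa [e2]

/-! ### Stripping prime factors from multiples close to integers. -/

/-- The integers `2 ^ a * 3 ^ b * 5 ^ c`. -/
def IsSmooth235 (s : ℕ) : Prop := ∃ a b c : ℕ, s = 2 ^ a * 3 ^ b * 5 ^ c

namespace IsSmooth235

theorem mul {s t : ℕ} (hs : IsSmooth235 s) (ht : IsSmooth235 t) : IsSmooth235 (s * t) := by
  obtain ⟨a, b, c, rfl⟩ := hs
  obtain ⟨a', b', c', rfl⟩ := ht
  exact ⟨a + a', b + b', c + c', by ring⟩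

theorem one : IsSmooth235 1 := ⟨0, 0, 0, by simp⟩

theorem pow {s : ℕ} (hs : IsSmooth235 s) (n : ℕ) : IsSmooth235 (s ^ n) := by
  induction n with
  | zero => simpa using one
  | succ n ih => rw [pow_succ]; exact ih.mul hs

theorem two : IsSmooth235 2 := ⟨1, 0, 0, by simp⟩

theorem three : IsSmooth235 3 := ⟨0, 1, 0, by simp⟩

theorem five : IsSmooth235 5 := ⟨0, 0, 1, by simp⟩

theorem pos {s : ℕ} (hs : IsSmooth235 s) : 0 < s := by
  obtain ⟨a, b, c, rfl⟩ := hs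
  positivity

end IsSmooth235

theorem nsmul_coe (n : ℕ) (t : ℝ) : n • (t : UnitAddCircle) = ((n * t : ℝ) : UnitAddCircle) := by
  rw [← AddCircle.coe_nsmul, nsmul_eq_mul]

theorem exists_eq_coe_div_of_nsmul_eq {n : ℕ} (hn : 0 < n) {z : UnitAddCircle} {ρ : ℝ}
    (h : n • z = (ρ : UnitAddCircle)) : ∃ u : ℤ, z = (((ρ + u) / n : ℝ) : UnitAddCircle) := by
  obtain ⟨θ, rfl⟩ := QuotientAddGroup.mk_surjective z
  change n • (θ : UnitAddCircle) = _ at h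
  change ∃ u : ℤ, (θ : UnitAddCircle) = _
  rw [nsmul_coe, ← sub_eq_zero, ← AddCircle.coe_sub, AddCircle.coe_eq_zero_iff] at h
  obtain ⟨u, hu⟩ := h
  have hn' : (n : ℝ) ≠ 0 := by positivity
  refine ⟨u, congrArg _ ?_⟩
  rw [eq_div_iff hn']
  simp only [zsmul_eq_mul, mul_one] at hu
  linarith

/-- If `Q p ^ a s' x` is within `O(p ^ a s' y)` of an integer, then either factors `p` can be
removed from the multiplier, or the multiples of `Q x` whose real scale is close to `H` come near
a prescribed point `v`. -/
theorem descend_prime {p g h : ℕ} (hp : p.Prime) (hg : 2 ≤ g) (hh : 2 ≤ h) (hgh : g.Coprime h)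
    (hgp : g.Coprime p) (hhp : h.Coprime p) (Q : ℕ) {C δ H : ℝ} (hδ : 0 < δ) (hH : 0 < H) :
    ∃ m : ℕ, ∃ κ > 0, ∀ (x : UnitAddCircle) (y : ℝ), 0 < y → ∀ (v : UnitAddCircle) (s a : ℕ),
      0 < s → (∃ ρ : ℝ, (Q * (p ^ a * s)) • x = (ρ : UnitAddCircle) ∧
        |ρ| ≤ C * ((p ^ a * s : ℕ) * y)) → ((p ^ a * s : ℕ) : ℝ) * y ≤ κ →
      (∃ b c d : ℕ, H ≤ ((p ^ d * s * (g ^ b * h ^ c) : ℕ) : ℝ) * y ∧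
        ((p ^ d * s * (g ^ b * h ^ c) : ℕ) : ℝ) * y ≤ H * (1 + δ) ∧
        ‖(Q * (p ^ d * s * (g ^ b * h ^ c))) • x - v‖ ≤ (1 + C * H) * δ) ∨
      ∃ a' ≤ m, a' ≤ a ∧ ∃ ρ : ℝ, (Q * (p ^ a' * s)) • x = (ρ : UnitAddCircle) ∧
        |ρ| ≤ C * ((p ^ a' * s : ℕ) * y) := by
  obtain ⟨m, hm⟩ := exists_pow_mul_pow_smul_fraction_near (K := 1) hp hg hh hgh hgp hhp
    one_pos hδ
  obtain ⟨T₀, hT₀, hT⟩ := hm (m + 1)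
  have hT₀p : 0 < T₀ := by linarith
  refine ⟨m, H / T₀, by positivity, fun x y hy v s a hs => ?_⟩
  have hpp : (0 : ℝ) < p := by exact_mod_cast hp.pos
  have hp1 : (1 : ℝ) ≤ p := by exact_mod_cast hp.one_lt.le
  induction a with
  | zero => exact fun h1 _ => Or.inr ⟨0, by omega, le_rfl, h1⟩
  | succ a ih =>
    rintro ⟨ρ, h1, h2⟩ hκ
    by_cases ham : a + 1 ≤ m
    · exact Or.inr ⟨a + 1, ham, le_rfl, ρ, h1, h2⟩
    have hstep : p • ((Q * (p ^ a * s)) • x) = (ρ : UnitAddCircle) := by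
      rw [← h1, smul_smul]; congr 1; ring
    obtain ⟨j, hj⟩ := exists_eq_coe_div_of_nsmul_eq hp.pos hstep
    -- If `p ∣ j`, a factor `p` comes off and `ρ / p` obeys the same bound. Otherwise going back `m`
    -- more factors gives a fraction with denominator `p ^ (m + 1)` and numerator prime to `p`,
    -- which powers of `g` and `h` can move anywhere.
    by_cases hpj : (p : ℤ) ∣ j
    · obtain ⟨i, rfl⟩ := hpj
      have e1 : (Q * (p ^ a * s)) • x = ((ρ / p : ℝ) : UnitAddCircle) := by
        have : (ρ + ((p * i : ℤ) : ℝ)) / p = ρ / p + i := by push_cast; field_simp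
        rw [hj, this, AddCircle.coe_add, coe_intCast_eq_zero, add_zero]
      have e2 : (((p ^ (a + 1) * s : ℕ) : ℝ) * y) = p * (((p ^ a * s : ℕ) : ℝ) * y) := by
        push_cast; ring
      have h3 : |ρ / p| ≤ C * ((p ^ a * s : ℕ) * y) := by
        rw [abs_div, abs_of_pos hpp, div_le_iff₀ hpp]
        rw [e2] at h2; linarith
      have h4 : (((p ^ a * s : ℕ) : ℝ) * y) ≤ H / T₀ := by
        refine le_trans ?_ hκ
        rw [e2]
        exact le_mul_of_one_le_left (by positivity) hp1
      rcases ih ⟨_, e1, h3⟩ h4 with h5 | ⟨a', h5, h6, h7⟩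
      · exact Or.inl h5
      · exact Or.inr ⟨a', h5, by omega, h7⟩
    · left
      obtain ⟨d, rfl⟩ : ∃ d, a = d + m := ⟨a - m, by omega⟩
      have hs2 : (p ^ (m + 1)) • ((Q * (p ^ d * s)) • x) = (ρ : UnitAddCircle) := by
        rw [← h1, smul_smul]; congr 1; ring
      obtain ⟨u, hu⟩ := exists_eq_coe_div_of_nsmul_eq (pow_pos hp.pos _) hs2
      push_cast at hu
      have hup : ¬ (p : ℤ) ∣ u := by
        intro hpu
        have e1 : (p ^ m) • ((Q * (p ^ d * s)) • x) = (Q * (p ^ (d + m) * s)) • x := by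
          rw [smul_smul]; congr 1; ring
        rw [hu, hj, nsmul_coe, ← sub_eq_zero, ← AddCircle.coe_sub,
          AddCircle.coe_eq_zero_iff] at e1
        obtain ⟨i, hi⟩ := e1
        have hi' : (i : ℝ) * p = u - j := by
          have : ((p ^ m : ℕ) : ℝ) * ((ρ + u) / (p : ℝ) ^ (m + 1)) = (ρ + u) / p := by
            push_cast; field_simp; ring
          rw [this] at hi
          simp only [zsmul_eq_mul, mul_one] at hi
          rw [hi]; field_simp; ring
        have hi'' : i * p = u - j := by exact_mod_cast hi'
        exact hpj ((dvd_sub_right hpu).mp ⟨i, by rw [← hi'']; ring⟩)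
      set S : ℝ := ((p ^ d * s : ℕ) : ℝ) * y with hS
      have hS0 : 0 < S := by have := pow_pos hp.pos d; positivity
      have eS : (((p ^ (d + m + 1) * s : ℕ) : ℝ) * y) = (p : ℝ) ^ (m + 1) * S := by
        rw [hS]; push_cast; ring
      have hpm : (1 : ℝ) ≤ (p : ℝ) ^ (m + 1) := one_le_pow₀ hp1
      have hTS : H / S ≥ T₀ := by
        have : S ≤ H / T₀ := by
          refine le_trans ?_ hκ
          rw [eS]
          exact le_mul_of_one_le_left hS0.le hpm
        rw [ge_iff_le, le_div_iff₀ hS0]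
        rw [le_div_iff₀ hT₀p] at this
        linarith
      set c₀ : ℝ := ρ / ((p : ℝ) ^ (m + 1) * S) with hc₀
      have hc₀C : |c₀| ≤ C := by
        rw [hc₀, abs_div, abs_of_pos (by positivity : 0 < (p : ℝ) ^ (m + 1) * S),
          div_le_iff₀ (by positivity)]
        rwa [eS] at h2
      -- The real part grows along with the scale and is about `c₀ * H` when the scale reaches `H`,
      -- so the fraction is aimed at `v` minus that amount.
      obtain ⟨b, c, -, -, hb1, hb2, hb3⟩ := hT (m + 1) (by omega) le_rfl u hup
        (v - ((c₀ * H : ℝ) : UnitAddCircle)) _ hTS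
      refine ⟨b, c, d, ?_, ?_, ?_⟩
      · rw [div_le_iff₀ hS0] at hb1
        refine hb1.trans_eq ?_
        rw [hS]; push_cast; ring
      · rw [div_mul_eq_mul_div, le_div_iff₀ hS0] at hb2
        refine le_trans (le_of_eq ?_) hb2
        rw [hS]; push_cast; ring
      · set G : ℝ := (g : ℝ) ^ b * (h : ℝ) ^ c with hG
        have e1 : (Q * (p ^ d * s * (g ^ b * h ^ c))) • x =
            (((c₀ * (G * S) : ℝ)) : UnitAddCircle) +
              ((G * (u / (p : ℝ) ^ (m + 1)) : ℝ) : UnitAddCircle) := by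
          have : Q * (p ^ d * s * (g ^ b * h ^ c)) = (g ^ b * h ^ c) * (Q * (p ^ d * s)) := by
            ring
          rw [this, mul_smul, hu, nsmul_coe, ← AddCircle.coe_add]
          congr 1
          rw [hc₀, hG]; push_cast
          field_simp
        have e2 : (Q * (p ^ d * s * (g ^ b * h ^ c))) • x - v =
            ((c₀ * (G * S - H) : ℝ) : UnitAddCircle) +
              (((G * (u / (p : ℝ) ^ (m + 1)) : ℝ) : UnitAddCircle) -
                (v - ((c₀ * H : ℝ) : UnitAddCircle))) := by
          rw [e1, mul_sub, AddCircle.coe_sub]; abel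
        rw [e2]
        refine (norm_add_le _ _).trans ?_
        have f1 : ‖((c₀ * (G * S - H) : ℝ) : UnitAddCircle)‖ ≤ C * (H * δ) := by
          refine (norm_coe_le_abs _).trans ?_
          rw [abs_mul]
          have : |G * S - H| ≤ H * δ := by
            rw [div_le_iff₀ hS0] at hb1
            rw [div_mul_eq_mul_div, le_div_iff₀ hS0] at hb2
            rw [abs_le]
            constructor <;> nlinarith
          exact mul_le_mul hc₀C this (abs_nonneg _) ((abs_nonneg _).trans hc₀C)
        linarith

/-- The primes `2`, `3`, `5` are stripped in turn. If no stage yields the desired point, the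
surviving multiplier divides the fixed number `P`, so `(Q * P) • x n` is `O(y n)`; this contradicts
its nonzero limit `(Q * P) • x'`. -/
theorem dense_scale_of_near_integer {x : ℕ → UnitAddCircle} {y : ℕ → ℝ} {x' : UnitAddCircle}
    (hx : Tendsto x atTop (𝓝 x')) (hx' : ∀ M : ℕ, 0 < M → M • x' ≠ 0) (hy : ∀ n, 0 < y n)
    (hy0 : Tendsto y atTop (𝓝 0)) {Q : ℕ} (hQ : 0 < Q) {C : ℝ}
    (hyp : ∀ κ > 0, ∀ N : ℕ, ∃ n ≥ N, ∃ s : ℕ, IsSmooth235 s ∧ (s : ℝ) * y n ≤ κ ∧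
      ∃ ρ : ℝ, (Q * s) • x n = (ρ : UnitAddCircle) ∧ |ρ| ≤ C * (s * y n))
    {H δ : ℝ} (hH : 0 < H) (hδ : 0 < δ) (v : UnitAddCircle) :
    ∃ n s : ℕ, IsSmooth235 s ∧ H ≤ (s : ℝ) * y n ∧ (s : ℝ) * y n ≤ H * (1 + δ) ∧
      ‖(Q * s) • x n - v‖ ≤ (1 + C * H) * δ := by
  obtain ⟨m₂, κ₂, hκ₂, h₂⟩ := descend_prime (p := 2) (g := 3) (h := 5) (by norm_num) (by norm_num)
    (by norm_num) (by norm_num) (by norm_num) (by norm_num) Q (C := C) hδ hH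
  obtain ⟨m₃, κ₃, hκ₃, h₃⟩ := descend_prime (p := 3) (g := 2) (h := 5) (by norm_num) (by norm_num)
    (by norm_num) (by norm_num) (by norm_num) (by norm_num) Q (C := C) hδ hH
  obtain ⟨m₅, κ₅, hκ₅, h₅⟩ := descend_prime (p := 5) (g := 2) (h := 3) (by norm_num) (by norm_num)
    (by norm_num) (by norm_num) (by norm_num) (by norm_num) Q (C := C) hδ hH
  set P : ℕ := 2 ^ m₂ * 3 ^ m₃ * 5 ^ m₅ with hP
  have hP0 : 0 < P := by positivity
  have hlim : Tendsto (fun n => ‖(Q * P) • x n‖ - C * (P * y n)) atTop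
      (𝓝 (‖(Q * P) • x'‖ - C * (P * 0))) :=
    ((hx.const_smul (Q * P)).norm).sub ((hy0.const_mul _).const_mul _)
  have hpos : 0 < ‖(Q * P) • x'‖ - C * (P * 0) := by
    simpa using hx' _ (Nat.mul_pos hQ hP0)
  obtain ⟨N, hN⟩ := eventually_atTop.mp (hlim.eventually (lt_mem_nhds hpos))
  obtain ⟨n, hn, s, ⟨a, b, c, rfl⟩, hs1, ρ, hρ1, hρ2⟩ := hyp (min κ₂ (min κ₃ κ₅)) (by positivity) N
  have mono : ∀ {s t : ℕ}, s ≤ t → (s : ℝ) * y n ≤ t * y n := fun h =>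
    mul_le_mul_of_nonneg_right (by exact_mod_cast h) (hy n).le
  rcases h₂ (x n) (y n) (hy n) v (3 ^ b * 5 ^ c) a (by positivity)
    ⟨ρ, by rw [← hρ1]; ring_nf, by convert hρ2 using 4; ring⟩
    (by rw [← mul_assoc]; exact hs1.trans (min_le_left _ _)) with
    ⟨i, j, d, k1, k2, k3⟩ | ⟨a', ha', haa', ρ', hρ1', hρ2'⟩
  · exact ⟨n, _, ⟨d, b + i, c + j, by ring⟩, k1, k2, k3⟩
  have hle1 : 2 ^ a' * 3 ^ b * 5 ^ c ≤ 2 ^ a * 3 ^ b * 5 ^ c := by gcongr; norm_num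
  rcases h₃ (x n) (y n) (hy n) v (2 ^ a' * 5 ^ c) b (by positivity)
    ⟨ρ', by rw [← hρ1']; ring_nf, by convert hρ2' using 4; ring⟩
    (by
      rw [show 3 ^ b * (2 ^ a' * 5 ^ c) = 2 ^ a' * 3 ^ b * 5 ^ c by ring]
      exact (mono hle1).trans (hs1.trans ((min_le_right _ _).trans (min_le_left _ _)))) with
    ⟨i, j, d, k1, k2, k3⟩ | ⟨b', hb', hbb', ρ'', hρ1'', hρ2''⟩
  · exact ⟨n, _, ⟨a' + i, d, c + j, by ring⟩, k1, k2, k3⟩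
  have hle2 : 2 ^ a' * 3 ^ b' * 5 ^ c ≤ 2 ^ a' * 3 ^ b * 5 ^ c := by gcongr; norm_num
  rcases h₅ (x n) (y n) (hy n) v (2 ^ a' * 3 ^ b') c (by positivity)
    ⟨ρ'', by rw [← hρ1'']; ring_nf, by convert hρ2'' using 4; ring⟩
    (by
      rw [show 5 ^ c * (2 ^ a' * 3 ^ b') = 2 ^ a' * 3 ^ b' * 5 ^ c by ring]
      exact (mono (hle2.trans hle1)).trans
        (hs1.trans ((min_le_right _ _).trans (min_le_right _ _)))) with
    ⟨i, j, d, k1, k2, k3⟩ | ⟨c', hc', hcc', σ, hσ1, hσ2⟩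
  · exact ⟨n, _, ⟨a' + i, b' + j, d, by ring⟩, k1, k2, k3⟩
  exfalso
  obtain ⟨r, hr⟩ : 5 ^ c' * (2 ^ a' * 3 ^ b') ∣ P := by
    rw [hP, mul_comm]
    exact Nat.mul_dvd_mul (Nat.mul_dvd_mul (pow_dvd_pow _ ha') (pow_dvd_pow _ hb'))
      (pow_dvd_pow _ hc')
  have e1 : (Q * P) • x n = ((r * σ : ℝ) : UnitAddCircle) := by
    rw [← nsmul_coe, ← hσ1, smul_smul, hr]; congr 1; ring
  have e2 : ‖(Q * P) • x n‖ ≤ C * (P * y n) := by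
    rw [e1]
    refine (norm_coe_le_abs _).trans ?_
    rw [abs_mul, Nat.abs_cast, hr]
    refine (mul_le_mul_of_nonneg_left hσ2 (Nat.cast_nonneg r)).trans_eq ?_
    push_cast; ring
  linarith [hN n hn]

/-! ### The dyadic solenoid and its invariant sets with a real scale. -/

theorem exists_lt_norm_sub_lt (u : ℕ → UnitAddCircle) {κ : ℝ} (hκ : 0 < κ) :
    ∃ i j : ℕ, i < j ∧ ‖u i - u j‖ < κ := by
  obtain ⟨a, -, φ, hφ, ha⟩ := isCompact_univ.tendsto_subseq (fun n => Set.mem_univ (u n))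
  obtain ⟨N, hN⟩ := Metric.cauchySeq_iff.mp ha.cauchySeq κ hκ
  refine ⟨φ N, φ (N + 1), hφ N.lt_succ_self, ?_⟩
  rw [← dist_eq_norm]
  exact hN N le_rfl (N + 1) (by omega)

theorem exists_coe_eq_abs_eq_norm (z : UnitAddCircle) :
    ∃ ρ : ℝ, (ρ : UnitAddCircle) = z ∧ |ρ| = ‖z‖ := by
  obtain ⟨θ, rfl⟩ := QuotientAddGroup.mk_surjective z
  refine ⟨θ - round θ, ?_, (UnitAddCircle.norm_eq).symm⟩
  rw [AddCircle.coe_sub, coe_intCast_eq_zero, sub_zero]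

/-- A compatible sequence of halves in the circle, that is, a point of the dyadic solenoid. -/
def IsHalving (w : ℕ → UnitAddCircle) : Prop := ∀ i, 2 • w (i + 1) = w i

namespace IsHalving

variable {w w' : ℕ → UnitAddCircle}

theorem pow_smul (hw : IsHalving w) (k i : ℕ) : 2 ^ k • w (i + k) = w i := by
  induction k with
  | zero => simp
  | succ k ih => rw [pow_succ, mul_smul, ← add_assoc, hw, ih]

theorem sub (hw : IsHalving w) (hw' : IsHalving w') : IsHalving (w - w') := fun i => by
  simp only [Pi.sub_apply, smul_sub, hw i, hw' i]

theorem shift (hw : IsHalving w) (k : ℕ) : IsHalving (fun i => w (k + i)) := fun i => hw (k + i)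

/-- A point of the solenoid starting at the real number `ρ` either stays on the real line, or
departs from it by a fraction with denominator a power of two. -/
theorem exists_departure (hw : IsHalving w) {ρ : ℝ} (h0 : w 0 = (ρ : UnitAddCircle))
    (h : ¬ ∀ i, w i = ((ρ / 2 ^ i : ℝ) : UnitAddCircle)) :
    ∃ I : ℕ, ∀ k : ℕ, ∃ u : ℤ, ¬ (2 : ℤ) ∣ u ∧
      w (I + k) = ((ρ / 2 ^ (I + k) + u / 2 ^ (k + 1) : ℝ) : UnitAddCircle) := by
  classical
  push Not at h
  obtain ⟨J, hJ⟩ : ∃ J, Nat.find h = J + 1 := by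
    refine ⟨Nat.find h - 1, ?_⟩
    have : Nat.find h ≠ 0 := fun h1 => by
      have h2 := Nat.find_spec h
      rw [h1] at h2
      exact h2 (by simpa using h0)
    omega
  have hlt : w J = ((ρ / 2 ^ J : ℝ) : UnitAddCircle) := by
    by_contra h1
    exact Nat.find_min h (by omega : J < Nat.find h) h1
  have hne := Nat.find_spec h
  rw [hJ] at hne
  -- `J` is the last index before the point first leaves the real line; an even numerator would put
  -- index `J + 1` on the line too.
  refine ⟨J + 1, fun k => ?_⟩
  have h1 : 2 ^ (k + 1) • w (J + (k + 1)) = ((ρ / 2 ^ J : ℝ) : UnitAddCircle) := by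
    rw [hw.pow_smul, hlt]
  obtain ⟨u, hu⟩ := exists_eq_coe_div_of_nsmul_eq (by positivity) h1
  push_cast at hu
  have e0 : J + 1 + k = J + (k + 1) := by ring
  refine ⟨u, ?_, ?_⟩
  · rintro ⟨e, rfl⟩
    apply hne
    rw [← hw.pow_smul k (J + 1), e0, hu, nsmul_coe]
    have : ((2 ^ k : ℕ) : ℝ) * ((ρ / 2 ^ J + ((2 * e : ℤ) : ℝ)) / 2 ^ (k + 1)) =
        ρ / 2 ^ (J + 1) + e := by
      push_cast; field_simp; ring
    rw [this, AddCircle.coe_add, coe_intCast_eq_zero, add_zero]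
  · rw [e0, hu]
    congr 1
    field_simp; ring

end IsHalving

/-- A closed set of pairs (point of the dyadic solenoid, real scale) invariant under
multiplication by `3 ^ K`, `5 ^ K` and `2 ^ (-K)`. -/
structure IsScaleSet (K : ℕ) (Y : Set ((ℕ → UnitAddCircle) × ℝ)) : Prop where
  closed : IsClosed Y
  halving : ∀ z ∈ Y, IsHalving z.1
  three : ∀ z ∈ Y, ((3 ^ K • z.1, 3 ^ K * z.2) : (ℕ → UnitAddCircle) × ℝ) ∈ Y
  five : ∀ z ∈ Y, ((5 ^ K • z.1, 5 ^ K * z.2) : (ℕ → UnitAddCircle) × ℝ) ∈ Y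
  half : ∀ z ∈ Y, ((fun i => z.1 (i + K), z.2 / 2 ^ K) : (ℕ → UnitAddCircle) × ℝ) ∈ Y

namespace IsScaleSet

variable {K : ℕ} {Y : Set ((ℕ → UnitAddCircle) × ℝ)}

theorem mul_mem (hY : IsScaleSet K Y) {z : (ℕ → UnitAddCircle) × ℝ} (hz : z ∈ Y) {a b c : ℕ}
    (ha : K ∣ a) (hb : K ∣ b) (hc : K ∣ c) :
    ((fun i => (3 ^ b * 5 ^ c) • z.1 (i + a), 3 ^ b * 5 ^ c * z.2 / 2 ^ a) :
      (ℕ → UnitAddCircle) × ℝ) ∈ Y := by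
  obtain ⟨a, rfl⟩ := ha
  obtain ⟨b, rfl⟩ := hb
  obtain ⟨c, rfl⟩ := hc
  have h1 : ((fun i => z.1 (i + K * a), z.2 / 2 ^ (K * a)) : (ℕ → UnitAddCircle) × ℝ) ∈ Y := by
    induction a with
    | zero => simpa using hz
    | succ a ih =>
      convert hY.half _ ih using 2
      · ext i; exact congrArg z.1 (by ring)
      · simp only; rw [div_div]; congr 1; ring
  have h2 : ((fun i => (3 ^ (K * b)) • z.1 (i + K * a), 3 ^ (K * b) * (z.2 / 2 ^ (K * a))) :
      (ℕ → UnitAddCircle) × ℝ) ∈ Y := by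
    induction b with
    | zero => simpa using h1
    | succ b ih =>
      convert hY.three _ ih using 2
      · ext i; simp only [Pi.smul_apply, smul_smul]; congr 1; ring
      · simp only; ring
  have h3 : ((fun i => (3 ^ (K * b) * 5 ^ (K * c)) • z.1 (i + K * a),
      3 ^ (K * b) * 5 ^ (K * c) * (z.2 / 2 ^ (K * a))) : (ℕ → UnitAddCircle) × ℝ) ∈ Y := by
    induction c with
    | zero => simpa using h2
    | succ c ih =>
      convert hY.five _ ih using 2
      · ext i; simp only [Pi.smul_apply, smul_smul]; congr 1; ring
      · simp only; ring
  rwa [mul_div_assoc]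

theorem of_one (hY : IsScaleSet 1 Y) (K : ℕ) : IsScaleSet K Y where
  closed := hY.closed
  halving := hY.halving
  three z hz := by
    have := hY.mul_mem hz (a := 0) (b := K) (c := 0) (one_dvd _) (one_dvd _) (one_dvd _)
    simp only [pow_zero, mul_one, add_zero, div_one] at this
    exact this
  five z hz := by
    have := hY.mul_mem hz (a := 0) (b := 0) (c := K) (one_dvd _) (one_dvd _) (one_dvd _)
    simp only [pow_zero, one_mul, add_zero, div_one] at this
    exact this
  half z hz := by
    have := hY.mul_mem hz (a := K) (b := 0) (c := 0) (one_dvd _) (one_dvd _) (one_dvd _)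
    simp only [pow_zero, one_mul, mul_one, one_smul] at this
    exact this

end IsScaleSet

/-- Points of the solenoid lying, up to torsion, on the real line. -/
def IsLeaf (w : ℕ → UnitAddCircle) : Prop :=
  ∃ (Q : ℤ) (r : ℝ) (i₀ : ℕ), Q ≠ 0 ∧ ∀ i, Q • w (i₀ + i) = ((r / 2 ^ i : ℝ) : UnitAddCircle)

namespace IsScaleSet

variable {K : ℕ} {Y : Set ((ℕ → UnitAddCircle) × ℝ)}

/-- Multipliers `3 ^ b * 5 ^ c / 2 ^ a` close to `1` give infinitely many points of almost the same
scale, and compactness makes two of them close at coordinate `a₀`. Were their difference on the real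
line, a multiple of `z.1` would be too. That multiple is an even minus an odd number, hence nonzero,
and `z.1` would be a leaf. -/
theorem exists_close_pair (hY : IsScaleSet K Y) (hK : 0 < K) {z : (ℕ → UnitAddCircle) × ℝ}
    (hz : z ∈ Y) (hz0 : 0 < z.2) (hleaf : ¬ IsLeaf z.1) (a₀ : ℕ) {κ ε : ℝ} (hκ : 0 < κ)
    (hε : 0 < ε) :
    ∃ z₁ ∈ Y, ∃ z₂ ∈ Y, z.2 ≤ z₁.2 ∧ z₁.2 ≤ z.2 * (1 + ε) ∧ z.2 ≤ z₂.2 ∧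
      z₂.2 ≤ z.2 * (1 + ε) ∧ ∃ ρ : ℝ, |ρ| < κ ∧ (z₁.1 - z₂.1) a₀ = (ρ : UnitAddCircle) ∧
        ¬ ∀ i, (z₁.1 - z₂.1) (a₀ + i) = ((ρ / 2 ^ i : ℝ) : UnitAddCircle) := by
  obtain ⟨T₀, hT₀, hT⟩ := exists_pow_mul_pow_near (g := 3) (h := 5) (by norm_num) (by norm_num)
    (by norm_num) hK hε
  obtain ⟨N, hN⟩ := pow_unbounded_of_one_lt T₀ (one_lt_two : (1 : ℝ) < 2)
  have hbc : ∀ j : ℕ, ∃ b c : ℕ, K ∣ b ∧ K ∣ c ∧ (2 : ℝ) ^ (K * (N + j)) ≤ 3 ^ b * 5 ^ c ∧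
      (3 : ℝ) ^ b * 5 ^ c ≤ 2 ^ (K * (N + j)) * (1 + ε) := by
    intro j
    have : (2 : ℝ) ^ (K * (N + j)) ≥ T₀ :=
      hN.le.trans (pow_le_pow_right₀ one_le_two (by nlinarith))
    obtain ⟨b, c, hb, hc, h1, h2⟩ := hT _ this 0
    exact ⟨b, c, (Nat.modEq_zero_iff_dvd).mp hb, hc, by exact_mod_cast h1, by exact_mod_cast h2⟩
  choose b c hb hc h1 h2 using hbc
  set Z : ℕ → (ℕ → UnitAddCircle) × ℝ := fun j =>
    (fun i => (3 ^ b j * 5 ^ c j) • z.1 (i + K * (N + j)),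
      3 ^ b j * 5 ^ c j * z.2 / 2 ^ (K * (N + j))) with hZ
  have hZY : ∀ j, Z j ∈ Y := fun j => hY.mul_mem hz (dvd_mul_right _ _) (hb j) (hc j)
  have hZ1 : ∀ j, z.2 ≤ (Z j).2 := fun j => by
    simp only [hZ]
    rw [le_div_iff₀ (by positivity), mul_comm]
    exact mul_le_mul_of_nonneg_right (h1 j) hz0.le
  have hZ2 : ∀ j, (Z j).2 ≤ z.2 * (1 + ε) := fun j => by
    simp only [hZ]
    rw [div_le_iff₀ (by positivity)]
    have := mul_le_mul_of_nonneg_right (h2 j) hz0.le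
    linarith
  obtain ⟨i, j, hij, hclose⟩ := exists_lt_norm_sub_lt (fun j => (Z j).1 a₀) hκ
  obtain ⟨ρ, hρ, hρ'⟩ := exists_coe_eq_abs_eq_norm ((Z i).1 a₀ - (Z j).1 a₀)
  refine ⟨Z i, hZY i, Z j, hZY j, hZ1 i, hZ2 i, hZ1 j, hZ2 j, ρ, by rwa [hρ'], hρ.symm,
    fun hall => hleaf ?_⟩
  obtain ⟨d, hd⟩ : ∃ d, K * (N + j) = K * (N + i) + (d + 1) := by
    have : K * (N + i) < K * (N + j) := Nat.mul_lt_mul_of_pos_left (by omega) hK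
    exact ⟨K * (N + j) - K * (N + i) - 1, by omega⟩
  refine ⟨(3 ^ b i * 5 ^ c i : ℕ) * 2 ^ (d + 1) - (3 ^ b j * 5 ^ c j : ℕ), ρ,
    a₀ + K * (N + j), ?_, fun k => ?_⟩
  · intro h0
    have hodd : Odd ((3 ^ b j * 5 ^ c j : ℕ) : ℤ) := by
      have : Odd (3 ^ b j * 5 ^ c j) :=
        (Odd.pow (by decide)).mul (Odd.pow (by decide))
      exact_mod_cast this
    have heven : Even ((3 ^ b j * 5 ^ c j : ℕ) : ℤ) := by
      rw [← sub_eq_zero.mp h0, pow_succ]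
      exact (even_two.mul_left _).mul_left _
    exact (Int.not_even_iff_odd.mpr hodd) heven
  · rw [← hall k]
    simp only [hZ, Pi.sub_apply]
    have e1 : z.1 (a₀ + k + K * (N + i)) = 2 ^ (d + 1) • z.1 (a₀ + k + K * (N + j)) := by
      rw [hd, ← add_assoc, (hY.halving z hz).pow_smul]
    have e2 : a₀ + K * (N + j) + k = a₀ + k + K * (N + j) := by ring
    rw [e1, e2, sub_smul, smul_smul, natCast_zsmul]
    congr 1

/-- A close pair off the leaves differs by a small real number plus an odd fraction `u / 2 ^ (k +
1)`. A multiplier `3 ^ b * 5 ^ c / 2 ^ a` of size between `1` and `2` moves the fraction to `v`,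
while the real part stays negligible. -/
theorem exists_approx_pair (hY : IsScaleSet K Y) (hK : 0 < K) {z : (ℕ → UnitAddCircle) × ℝ}
    (hz : z ∈ Y) (hz0 : 0 < z.2) (hleaf : ¬ IsLeaf z.1) (m : ℕ) (v : UnitAddCircle) {δ : ℝ}
    (hδ : 0 < δ) :
    ∃ z₁ ∈ Y, ∃ z₂ ∈ Y, z.2 ≤ z₁.2 ∧ z₁.2 ≤ 4 * z.2 ∧ |z₁.2 - z₂.2| ≤ δ ∧
      ‖z₁.1 m - z₂.1 m - v‖ < δ := by
  set δ' := min 1 (δ / 2) with hδ'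
  have hδ'0 : 0 < δ' := by positivity
  obtain ⟨L₀, hL₀⟩ := exists_pow_mul_pow_smul_fraction_near (p := 2) (g := 3) (h := 5)
    Nat.prime_two (by norm_num) (by norm_num) (by norm_num) (by norm_num) (by norm_num) hK hδ'0
  obtain ⟨T₀, hT₀, hT⟩ := hL₀ (L₀ + m + K + 1)
  obtain ⟨a₀, ha₀⟩ := pow_unbounded_of_one_lt T₀ (one_lt_two : (1 : ℝ) < 2)
  set ε := min 1 (δ / (2 * z.2)) with hε
  have hε0 : 0 < ε := by positivity
  obtain ⟨z₁, hz₁, z₂, hz₂, t1, t2, t3, t4, ρ, hρ, hd0, hdn⟩ :=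
    hY.exists_close_pair hK hz hz0 hleaf a₀ (κ := δ / 2 ^ (a₀ + 3)) (by positivity) hε0
  have hh : IsHalving (z₁.1 - z₂.1) := (hY.halving _ hz₁).sub (hY.halving _ hz₂)
  obtain ⟨I, hI⟩ := (hh.shift a₀).exists_departure hd0 hdn
  -- The departure index `I` is not controlled, but `k` lies in a window fixed before `a₀`, so the
  -- threshold `T₀` still applies. The window has room to make the shift `a` divisible by `K`.
  obtain ⟨k, hk1, hk2, hk3⟩ : ∃ k, L₀ + m ≤ k ∧ k ≤ L₀ + m + K ∧ K ∣ a₀ + I + k - m := by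
    have hlt := Nat.mod_lt (a₀ + I + L₀) hK
    refine ⟨L₀ + m + (K - (a₀ + I + L₀) % K), by omega, by omega, ?_⟩
    have h1 := Nat.mod_add_div (a₀ + I + L₀) K
    refine ⟨(a₀ + I + L₀) / K + 1, ?_⟩
    rw [mul_add, mul_one]
    omega
  obtain ⟨u, hu, hdu⟩ := hI k
  set a := a₀ + I + k - m with ha
  have ham : a + m = a₀ + (I + k) := by omega
  obtain ⟨b, c, hb, hc, h1, h2, h3⟩ := hT (k + 1) (by omega) (by omega) u hu v (2 ^ a)
    (ha₀.le.trans (pow_le_pow_right₀ one_le_two (by omega)))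
  push_cast at h1 h2 h3
  set G : ℝ := 3 ^ b * 5 ^ c with hG
  have h2a : (0 : ℝ) < 2 ^ a := by positivity
  have hG2 : G ≤ 2 * 2 ^ a := by
    have : δ' ≤ 1 := min_le_left _ _
    nlinarith
  have hε1 : z.2 * (1 + ε) ≤ 2 * z.2 := by
    have : ε ≤ 1 := min_le_left _ _
    nlinarith
  have hε2 : z.2 * ε ≤ δ / 2 := by
    have : ε ≤ δ / (2 * z.2) := min_le_right _ _
    calc z.2 * ε ≤ z.2 * (δ / (2 * z.2)) := by gcongr
      _ = δ / 2 := by field_simp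
  refine ⟨_, hY.mul_mem hz₁ hk3 hb hc, _, hY.mul_mem hz₂ hk3 hb hc, ?_, ?_, ?_, ?_⟩
  · simp only
    rw [le_div_iff₀ h2a]
    nlinarith
  · simp only
    rw [div_le_iff₀ h2a]
    nlinarith
  · simp only
    rw [← sub_div, ← mul_sub, abs_div, abs_of_pos h2a, div_le_iff₀ h2a, abs_mul,
      abs_of_pos (by positivity : 0 < G)]
    have : |z₁.2 - z₂.2| ≤ δ / 2 := by rw [abs_le]; constructor <;> linarith
    calc G * |z₁.2 - z₂.2| ≤ (2 * 2 ^ a) * (δ / 2) := by gcongr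
      _ = δ * 2 ^ a := by ring
  · simp only
    have hdu' : z₁.1 (m + a) - z₂.1 (m + a) =
        ((ρ / 2 ^ (I + k) + u / 2 ^ (k + 1) : ℝ) : UnitAddCircle) := by
      rw [← hdu, ← ham, add_comm m a]; rfl
    have e1 : (3 ^ b * 5 ^ c) • z₁.1 (m + a) - (3 ^ b * 5 ^ c) • z₂.1 (m + a) - v =
        ((G * (ρ / 2 ^ (I + k)) : ℝ) : UnitAddCircle) +
          (((G * (u / 2 ^ (k + 1)) : ℝ) : UnitAddCircle) - v) := by
      rw [← smul_sub, hdu', nsmul_coe, add_sub, ← AddCircle.coe_add, hG]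
      congr 2
      push_cast; ring
    rw [e1]
    refine (norm_add_le _ _).trans_lt ?_
    have f1 : ‖((G * (ρ / 2 ^ (I + k)) : ℝ) : UnitAddCircle)‖ ≤ δ / 4 := by
      refine (norm_coe_le_abs _).trans ?_
      rw [abs_mul, abs_of_pos (by positivity : 0 < G), abs_div,
        abs_of_pos (by positivity : (0 : ℝ) < 2 ^ (I + k))]
      have ea : (2 : ℝ) ^ a ≤ 2 ^ a₀ * 2 ^ (I + k) := by
        rw [← pow_add]; exact pow_le_pow_right₀ one_le_two (by omega)
      calc G * (|ρ| / 2 ^ (I + k))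
          ≤ (2 * (2 ^ a₀ * 2 ^ (I + k))) * (δ / 2 ^ (a₀ + 3) / 2 ^ (I + k)) := by
            gcongr; linarith
        _ = δ / 4 := by field_simp; ring
    have f2 : δ' ≤ δ / 2 := min_le_right _ _
    linarith

theorem exists_translate_mem (hY : IsScaleSet K Y) (hK : 0 < K) {z : (ℕ → UnitAddCircle) × ℝ}
    (hz : z ∈ Y) (hz0 : 0 < z.2) (hleaf : ¬ IsLeaf z.1) {v : ℕ → UnitAddCircle}
    (hv : IsHalving v) : ∃ z' ∈ Y, 0 < z'.2 ∧ ((z'.1 + v, z'.2) : (ℕ → UnitAddCircle) × ℝ) ∈ Y := by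
  -- Passing from coordinate `n` down to `i` multiplies the error by `2 ^ (n - i)`; precision `4 ^
  -- (-n)` survives this, so a limit pair has equal scales and differs exactly by `v`.
  have hp : ∀ n : ℕ, ∃ Z : ((ℕ → UnitAddCircle) × ℝ) × ((ℕ → UnitAddCircle) × ℝ),
      Z.1 ∈ Y ∧ Z.2 ∈ Y ∧ z.2 ≤ Z.1.2 ∧ Z.1.2 ≤ 4 * z.2 ∧ |Z.1.2 - Z.2.2| ≤ (1 / 4) ^ n ∧
        ‖Z.1.1 n - Z.2.1 n - v n‖ < (1 / 4) ^ n := by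
    intro n
    obtain ⟨z₁, h1, z₂, h2, h⟩ := hY.exists_approx_pair hK hz hz0 hleaf n (v n)
      (δ := (1 / 4) ^ n) (by positivity)
    exact ⟨(z₁, z₂), h1, h2, h⟩
  choose Z hZ1 hZ2 hZ3 hZ4 hZ5 hZ6 using hp
  have hpow : ∀ n : ℕ, ((1 : ℝ) / 4) ^ n ≤ 1 := fun n => pow_le_one₀ (by norm_num) (by norm_num)
  have hcomp : IsCompact (((Set.univ : Set (ℕ → UnitAddCircle)) ×ˢ Set.Icc z.2 (4 * z.2)) ×ˢ
      ((Set.univ : Set (ℕ → UnitAddCircle)) ×ˢ Set.Icc (z.2 - 1) (4 * z.2 + 1))) :=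
    (isCompact_univ.prod isCompact_Icc).prod (isCompact_univ.prod isCompact_Icc)
  obtain ⟨⟨x₁, x₂⟩, hx, φ, hφ, hlim⟩ := hcomp.tendsto_subseq (x := Z) (fun n => by
    have := abs_le.mp (hZ5 n)
    have := hpow n
    have := hZ3 n
    have := hZ4 n
    refine ⟨⟨Set.mem_univ _, hZ3 n, hZ4 n⟩, Set.mem_univ _, ?_, ?_⟩ <;> linarith)
  have l1 : Tendsto (fun n => (Z (φ n)).1) atTop (𝓝 x₁) := (continuous_fst.tendsto _).comp hlim
  have l2 : Tendsto (fun n => (Z (φ n)).2) atTop (𝓝 x₂) := (continuous_snd.tendsto _).comp hlim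
  have hx₁ : x₁ ∈ Y := hY.closed.mem_of_tendsto l1 (Eventually.of_forall fun n => hZ1 _)
  have hx₂ : x₂ ∈ Y := hY.closed.mem_of_tendsto l2 (Eventually.of_forall fun n => hZ2 _)
  have hφ4 : Tendsto (fun n => ((1 : ℝ) / 4) ^ φ n) atTop (𝓝 0) :=
    (tendsto_pow_atTop_nhds_zero_of_lt_one (by norm_num) (by norm_num)).comp hφ.tendsto_atTop
  have hτ : x₁.2 = x₂.2 := by
    rw [← sub_eq_zero]
    refine tendsto_nhds_unique (((continuous_snd.tendsto _).comp l1).sub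
      ((continuous_snd.tendsto _).comp l2)) (squeeze_zero_norm (fun n => ?_) hφ4)
    simpa using hZ5 (φ n)
  have hw : ∀ i, x₁.1 i = x₂.1 i + v i := by
    intro i
    have c1 : Continuous fun z : (ℕ → UnitAddCircle) × ℝ => z.1 i :=
      (continuous_apply i).comp continuous_fst
    have hφ2 : Tendsto (fun n => ((1 : ℝ) / 2) ^ φ n) atTop (𝓝 0) :=
      (tendsto_pow_atTop_nhds_zero_of_lt_one (by norm_num) (by norm_num)).comp hφ.tendsto_atTop
    have : x₁.1 i - x₂.1 i - v i = 0 := by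
      refine tendsto_nhds_unique ((((c1.tendsto _).comp l1).sub ((c1.tendsto _).comp l2)).sub_const
        (v i)) (squeeze_zero_norm' ?_ hφ2)
      filter_upwards [eventually_ge_atTop i] with n hn
      obtain ⟨k, hk⟩ : ∃ k, φ n = i + k := ⟨φ n - i, by have := hφ.le_apply (x := n); omega⟩
      have e : (Z (φ n)).1.1 i - (Z (φ n)).2.1 i - v i =
          2 ^ k • ((Z (φ n)).1.1 (φ n) - (Z (φ n)).2.1 (φ n) - v (φ n)) := by
        rw [hk, smul_sub, smul_sub, (hY.halving _ (hZ1 _)).pow_smul,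
          (hY.halving _ (hZ2 _)).pow_smul, hv.pow_smul]
      simp only [Function.comp]
      rw [e]
      refine (norm_nsmul_le).trans ?_
      push_cast
      calc (2 : ℝ) ^ k * ‖(Z (φ n)).1.1 (φ n) - (Z (φ n)).2.1 (φ n) - v (φ n)‖
          ≤ 2 ^ (φ n) * (1 / 4) ^ (φ n) := by
            gcongr
            · exact one_le_two
            · omega
            · exact (hZ6 _).le
        _ = (1 / 2) ^ φ n := by rw [← mul_pow]; norm_num
    rw [sub_sub, sub_eq_zero] at this
    exact this
  refine ⟨x₂, hx₂, hτ ▸ hz0.trans_le hx.1.2.1, ?_⟩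
  have : ((x₂.1 + v, x₂.2) : (ℕ → UnitAddCircle) × ℝ) = x₁ :=
    Prod.ext (funext fun i => (hw i).symm) hτ.symm
  rwa [this]

/-- Since `v` is fixed by the `K`-th powers of the three maps, the points `x` of a scale set for
which `x + v` is also in it form another scale set. It still has points of positive scale and no
leaves there, so the step can be repeated. -/
theorem exists_translates_mem (hY : IsScaleSet K Y) (hK : 0 < K)
    (hleaf : ∀ z ∈ Y, 0 < z.2 → ¬ IsLeaf z.1) (hne : ∃ z ∈ Y, 0 < z.2) {v : ℕ → UnitAddCircle}
    (hv : IsHalving v) (hv3 : 3 ^ K • v = v) (hv5 : 5 ^ K • v = v) (hv2 : ∀ i, v (i + K) = v i)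
    (n : ℕ) :
    ∃ z ∈ Y, 0 < z.2 ∧ ∀ i ≤ n, ((z.1 + i • v, z.2) : (ℕ → UnitAddCircle) × ℝ) ∈ Y := by
  suffices ∃ Y' ⊆ Y, IsScaleSet K Y' ∧ (∃ z ∈ Y', 0 < z.2) ∧ ∀ z ∈ Y', ∀ i ≤ n,
      ((z.1 + i • v, z.2) : (ℕ → UnitAddCircle) × ℝ) ∈ Y by
    obtain ⟨Y', -, -, ⟨z, hz, hz0⟩, h⟩ := this
    exact ⟨z, by simpa using h z hz 0 (Nat.zero_le _), hz0, h z hz⟩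
  induction n with
  | zero =>
    refine ⟨Y, le_rfl, hY, hne, fun z hz i hi => ?_⟩
    obtain rfl : i = 0 := by omega
    simpa using hz
  | succ n ih =>
    obtain ⟨Y', hsub, hY', ⟨z, hz, hz0⟩, h⟩ := ih
    obtain ⟨z', hz', hz'0, hz'v⟩ := hY'.exists_translate_mem hK hz hz0 (hleaf z (hsub hz) hz0) hv
    refine ⟨{x | x ∈ Y' ∧ ((x.1 + v, x.2) : (ℕ → UnitAddCircle) × ℝ) ∈ Y'}, fun x hx => hsub hx.1,
      ⟨?_, fun x hx => hY'.halving x hx.1, fun x hx => ⟨hY'.three x hx.1, ?_⟩,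
        fun x hx => ⟨hY'.five x hx.1, ?_⟩, fun x hx => ⟨hY'.half x hx.1, ?_⟩⟩,
      ⟨z', ⟨hz', hz'v⟩, hz'0⟩, fun x hx i hi => ?_⟩
    · exact hY'.closed.inter (hY'.closed.preimage (by fun_prop))
    · convert hY'.three _ hx.2 using 2
      simp only [smul_add, hv3]
    · convert hY'.five _ hx.2 using 2
      simp only [smul_add, hv5]
    · convert hY'.half _ hx.2 using 2
      ext i
      simp [hv2 i]
    · rcases Nat.eq_zero_or_pos i with rfl | hi0
      · simpa using hsub hx.1
      · obtain ⟨j, rfl⟩ : ∃ j, i = j + 1 := ⟨i - 1, by omega⟩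
        convert h _ hx.2 j (by omega) using 2
        simp only [succ_nsmul]
        abel

end IsScaleSet

/-! ### Accumulation at positive scale and density in the half-cylinder. -/

theorem coe_div_eq_of_modEq {q a b : ℕ} (hq : 0 < q) (h : a ≡ b [MOD q]) :
    (((a : ℝ) / q : ℝ) : UnitAddCircle) = (((b : ℝ) / q : ℝ) : UnitAddCircle) := by
  obtain ⟨k, hk⟩ := Nat.modEq_iff_dvd.mp h
  have hk' : (b : ℝ) = a + q * k := by
    have : (b : ℤ) = a + q * k := by linarith
    exact_mod_cast this
  have hq' : (q : ℝ) ≠ 0 := by positivity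
  have : (b : ℝ) / q = a / q + k := by rw [hk']; field_simp
  rw [this, AddCircle.coe_add, coe_intCast_eq_zero, add_zero]

theorem exists_le_nsmul_near {q c : ℕ} (hq : 0 < q) (hc : c.Coprime q) (θ : UnitAddCircle) :
    ∃ i ≤ q, ‖i • (((c : ℝ) / q : ℝ) : UnitAddCircle) - θ‖ ≤ 1 / q := by
  obtain ⟨θ, rfl⟩ := QuotientAddGroup.mk_surjective θ
  change ∃ i ≤ q, ‖i • (((c : ℝ) / q : ℝ) : UnitAddCircle) - (θ : UnitAddCircle)‖ ≤ 1 / q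
  have hq' : (0 : ℝ) < q := by exact_mod_cast hq
  have hqz : (0 : ℤ) < q := by exact_mod_cast hq
  obtain ⟨a, b, hab⟩ := Nat.isCoprime_iff_coprime.mpr hc
  set E := ⌊θ * q⌋
  obtain ⟨i, hi⟩ := Int.eq_ofNat_of_zero_le (Int.emod_nonneg (E * a) hqz.ne')
  have hi' : (i : ℤ) = (E * a) % q := hi.symm
  have h2 := Int.emod_add_mul_ediv (E * a) q
  rw [← hi'] at h2
  refine ⟨i, by have := Int.emod_lt_of_pos (E * a) hqz; omega, ?_⟩
  have hz : (i : ℤ) * c = E + q * (-(b * E) - c * (E * a / q)) := by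
    linear_combination (c : ℤ) * h2 + E * hab
  have hr : (i : ℝ) * c = E + q * ((-(b * E) - c * (E * a / q) : ℤ) : ℝ) := by
    exact_mod_cast hz
  have e1 : (i : ℝ) * (c / q) = E / q + ((-(b * E) - c * (E * a / q) : ℤ) : ℝ) := by
    rw [← mul_div_assoc, hr, add_div, mul_div_cancel_left₀ _ hq'.ne']
  rw [nsmul_coe, e1, AddCircle.coe_add, coe_intCast_eq_zero, add_zero, ← AddCircle.coe_sub]
  refine (norm_coe_le_abs _).trans ?_
  have e2 : (E : ℝ) / q - θ = (E - θ * q) / q := by field_simp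
  rw [e2, abs_div, abs_of_pos hq']
  gcongr
  have := Int.floor_le (θ * q)
  have := Int.lt_floor_add_one (θ * q)
  rw [abs_le]
  constructor <;> linarith

/-- The accumulation set of the points `(s x n, s y n)`, with `s` in the semigroup generated by
`2, 3, 5` and `n → ∞`; the second coordinate is kept as a real number. -/
def scaleLimitSet (x : ℕ → UnitAddCircle) (y : ℕ → ℝ) : Set (UnitAddCircle × ℝ) :=
  ⋂ N : ℕ, closure {p | ∃ n ≥ N, ∃ s : ℕ, IsSmooth235 s ∧ p = (s • x n, s * y n)}

section scaleLimitSet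

variable {x : ℕ → UnitAddCircle} {y : ℕ → ℝ}

theorem isClosed_scaleLimitSet : IsClosed (scaleLimitSet x y) :=
  isClosed_iInter fun _ => isClosed_closure

theorem smul_mem_scaleLimitSet {p : UnitAddCircle × ℝ} (hp : p ∈ scaleLimitSet x y) {s : ℕ}
    (hs : IsSmooth235 s) : ((s • p.1, s * p.2) : UnitAddCircle × ℝ) ∈ scaleLimitSet x y := by
  refine Set.mem_iInter.mpr fun N => ?_
  have hc : Continuous fun p : UnitAddCircle × ℝ => ((s • p.1, s * p.2) : UnitAddCircle × ℝ) := by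
    fun_prop
  refine map_mem_closure
    (f := fun p : UnitAddCircle × ℝ => ((s • p.1, s * p.2) : UnitAddCircle × ℝ)) hc (Set.mem_iInter.mp hp N) ?_
  rintro _ ⟨n, hn, t, ht, rfl⟩
  exact ⟨n, hn, s * t, hs.mul ht, by simp [mul_smul, mul_assoc]⟩

theorem exists_near_of_mem_scaleLimitSet {u : UnitAddCircle} {t : ℝ}
    (h : (u, t) ∈ scaleLimitSet x y) (N : ℕ) {ε : ℝ} (hε : 0 < ε) :
    ∃ n ≥ N, ∃ s : ℕ, IsSmooth235 s ∧ |s * y n - t| < ε ∧ ‖s • x n - u‖ < ε := by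
  obtain ⟨_, ⟨n, hn, s, hs, rfl⟩, hd⟩ := Metric.mem_closure_iff.mp (Set.mem_iInter.mp h N) ε hε
  rw [Prod.dist_eq, max_lt_iff, dist_comm, dist_eq_norm, dist_comm, Real.dist_eq] at hd
  exact ⟨n, hn, s, hs, hd.2, hd.1⟩

/-- The backward histories under multiplication by `2` inside `scaleLimitSet`. -/
def scaleHistorySet (x : ℕ → UnitAddCircle) (y : ℕ → ℝ) : Set ((ℕ → UnitAddCircle) × ℝ) :=
  {z | IsHalving z.1 ∧ ∀ i, (z.1 i, z.2 / 2 ^ i) ∈ scaleLimitSet x y}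

theorem isScaleSet_scaleHistorySet : IsScaleSet 1 (scaleHistorySet x y) where
  closed := by
    have h1 : IsClosed {z : (ℕ → UnitAddCircle) × ℝ | IsHalving z.1} := by
      simp only [IsHalving, Set.ofPred_forall]
      exact isClosed_iInter fun i => isClosed_eq (by fun_prop) (by fun_prop)
    have h2 : IsClosed {z : (ℕ → UnitAddCircle) × ℝ |
        ∀ i, (z.1 i, z.2 / 2 ^ i) ∈ scaleLimitSet x y} := by
      simp only [Set.ofPred_forall]
      exact isClosed_iInter fun i => isClosed_scaleLimitSet.preimage
        (f := fun z : (ℕ → UnitAddCircle) × ℝ => (z.1 i, z.2 / 2 ^ i)) (by fun_prop)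
    exact h1.inter h2
  halving z hz := hz.1
  three z hz := by
    refine ⟨fun i => ?_, fun i => ?_⟩
    · simp only [Pi.smul_apply]
      rw [smul_comm, hz.1 i]
    · have := smul_mem_scaleLimitSet (hz.2 i) IsSmooth235.three
      simpa [mul_div_assoc] using this
  five z hz := by
    refine ⟨fun i => ?_, fun i => ?_⟩
    · simp only [Pi.smul_apply]
      rw [smul_comm, hz.1 i]
    · have := smul_mem_scaleLimitSet (hz.2 i) IsSmooth235.five
      simpa [mul_div_assoc] using this
  half z hz := by
    refine ⟨fun i => hz.1 (i + 1), fun i => ?_⟩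
    have := hz.2 (i + 1)
    rw [pow_succ'] at this
    simpa [div_div] using this

/-- Powers of `2` bring the scales `y n` into `[1/2, 1]`. The exponents tend to infinity, so the
partial histories lengthen and a limit is a full history; the truncated subtraction `a n - i`
matters only for finitely many `n`. -/
theorem exists_mem_scaleHistorySet (hy : ∀ n, 0 < y n) (hy0 : Tendsto y atTop (𝓝 0)) :
    ∃ z ∈ scaleHistorySet x y, 0 < z.2 := by
  obtain ⟨N₀, hN₀⟩ := eventually_atTop.mp (hy0.eventually (gt_mem_nhds one_pos))
  have ha : ∀ n, ∃ a : ℕ, 1 / 2 ≤ 2 ^ a * y (N₀ + n) ∧ 2 ^ a * y (N₀ + n) ≤ 1 := by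
    intro n
    have hyn := hy (N₀ + n)
    obtain ⟨a, h1, h2⟩ := exists_nat_pow_near
      ((one_le_div hyn).mpr (hN₀ (N₀ + n) (by omega)).le) (one_lt_two : (1 : ℝ) < 2)
    rw [le_div_iff₀ hyn] at h1
    rw [div_lt_iff₀ hyn, pow_succ] at h2
    exact ⟨a, by linarith, h1⟩
  choose a ha1 ha2 using ha
  have hainf : ∀ i, ∀ᶠ n in atTop, i ≤ a n := by
    intro i
    obtain ⟨N, hN⟩ := eventually_atTop.mp
      (hy0.eventually (gt_mem_nhds (by positivity : (0 : ℝ) < 1 / (2 * 2 ^ i))))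
    filter_upwards [eventually_ge_atTop N] with n hn
    by_contra hlt
    have h1 := hN (N₀ + n) (by omega)
    rw [lt_div_iff₀ (by positivity)] at h1
    have h2 : (2 : ℝ) ^ a n ≤ 2 ^ i := pow_le_pow_right₀ one_le_two (by omega)
    have h3 := mul_le_mul_of_nonneg_right h2 (hy (N₀ + n)).le
    have := ha1 n
    linarith
  set Z : ℕ → (ℕ → UnitAddCircle) × ℝ := fun n =>
    (fun i => 2 ^ (a n - i) • x (N₀ + n), 2 ^ a n * y (N₀ + n)) with hZ
  have hcomp : IsCompact ((Set.univ : Set (ℕ → UnitAddCircle)) ×ˢ Set.Icc (1 / 2 : ℝ) 1) :=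
    isCompact_univ.prod isCompact_Icc
  obtain ⟨z, hz, φ, hφ, hlim⟩ := hcomp.tendsto_subseq (x := Z)
    (fun n => ⟨Set.mem_univ _, ha1 n, ha2 n⟩)
  have c1 : ∀ i, Tendsto (fun n => (Z (φ n)).1 i) atTop (𝓝 (z.1 i)) := fun i =>
    (((continuous_apply i).comp continuous_fst).tendsto _).comp hlim
  have c2 : Tendsto (fun n => (Z (φ n)).2) atTop (𝓝 z.2) := (continuous_snd.tendsto _).comp hlim
  refine ⟨z, ⟨fun i => ?_, fun i => ?_⟩, lt_of_lt_of_le (by norm_num) hz.2.1⟩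
  · refine tendsto_nhds_unique_of_eventuallyEq ((c1 (i + 1)).const_smul 2) (c1 i) ?_
    filter_upwards [hφ.tendsto_atTop.eventually (hainf (i + 1))] with n hn
    simp only [hZ, smul_smul, ← pow_succ']
    congr 2
    omega
  · refine Set.mem_iInter.mpr fun N => mem_closure_of_tendsto
      ((c1 i).prodMk_nhds (c2.div_const (2 ^ i))) ?_
    filter_upwards [hφ.tendsto_atTop.eventually (hainf i), eventually_ge_atTop N] with n hn hn'
    refine ⟨N₀ + φ n, by have := hφ.le_apply (x := n); omega, 2 ^ (a (φ n) - i),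
      IsSmooth235.two.pow _, ?_⟩
    simp only [hZ, Prod.mk.injEq, true_and]
    obtain ⟨k, hk⟩ : ∃ k, a (φ n) = k + i := ⟨a (φ n) - i, by omega⟩
    rw [hk, Nat.add_sub_cancel]
    push_cast
    field_simp
    ring

theorem IsLeaf.exists_nat {w : ℕ → UnitAddCircle} (h : IsLeaf w) :
    ∃ (Q : ℕ) (r : ℝ) (i₀ : ℕ), 0 < Q ∧
      ∀ i, Q • w (i₀ + i) = ((r / 2 ^ i : ℝ) : UnitAddCircle) := by
  obtain ⟨Q, r, i₀, hQ, h⟩ := h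
  rcases Int.natAbs_eq Q with hQ' | hQ'
  · refine ⟨Q.natAbs, r, i₀, Int.natAbs_pos.mpr hQ, fun i => ?_⟩
    rw [← h i, ← natCast_zsmul, ← hQ']
  · refine ⟨Q.natAbs, -r, i₀, Int.natAbs_pos.mpr hQ, fun i => ?_⟩
    have e : ((Q.natAbs : ℕ) : ℤ) = -Q := by omega
    rw [neg_div, AddCircle.coe_neg, ← h i, ← natCast_zsmul, e, neg_smul]

/-- Along a leaf history the real position `r / 2 ^ i` and the scale decay at the same rate.
Approximating deep entries by `s • x n` therefore gives the near-integer hypothesis with the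
constant `C`, at arbitrarily small scales. -/
theorem dense_scale_of_leaf {x' : UnitAddCircle}
    (hx : Tendsto x atTop (𝓝 x')) (hx' : ∀ M : ℕ, 0 < M → M • x' ≠ 0) (hy : ∀ n, 0 < y n)
    (hy0 : Tendsto y atTop (𝓝 0)) {z : (ℕ → UnitAddCircle) × ℝ} (hz : z ∈ scaleHistorySet x y)
    (hz0 : 0 < z.2) (hleaf : IsLeaf z.1) :
    ∃ Q : ℕ, 0 < Q ∧ ∀ H > 0, ∀ v : UnitAddCircle, ∀ ε > 0, ∃ n s : ℕ, IsSmooth235 s ∧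
      |s * y n - H| < ε ∧ ‖(Q * s) • x n - v‖ < ε := by
  obtain ⟨Q, r, i₀, hQ, hQr⟩ := hleaf.exists_nat
  refine ⟨Q, hQ, fun H hH v ε hε => ?_⟩
  set C : ℝ := (|r| + 1) * 2 ^ (i₀ + 1) / z.2 with hC
  have hC0 : 0 < C := by positivity
  set δ : ℝ := ε / (2 * (1 + C * H + H)) with hδ
  have hδ0 : 0 < δ := by positivity
  have hδε : (1 + C * H + H) * δ = ε / 2 := by rw [hδ]; field_simp
  obtain ⟨n, s, hs, h1, h2, h3⟩ := dense_scale_of_near_integer hx hx' hy hy0 hQ (C := C) (by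
    intro κ hκ N
    obtain ⟨i, hi⟩ := exists_pow_lt_of_lt_one (by positivity : 0 < κ / (2 * z.2))
      (by norm_num : (1 / 2 : ℝ) < 1)
    set t : ℝ := z.2 / 2 ^ (i₀ + i) with ht
    have ht0 : 0 < t := by positivity
    have htκ : 2 * t ≤ κ := by
      rw [lt_div_iff₀ (by positivity), one_div, inv_pow] at hi
      have : t ≤ (2 ^ i)⁻¹ * z.2 := by
        rw [ht, div_eq_inv_mul]
        gcongr
        · exact one_le_two
        · omega
      linarith
    obtain ⟨n, hn, s, hs, h1, h2⟩ := exists_near_of_mem_scaleLimitSet (hz.2 (i₀ + i)) N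
      (ε := min (t / 2) (1 / (Q * 2 ^ i))) (by positivity)
    have h1' := abs_lt.mp (h1.trans_le (min_le_left _ _))
    have h2' := h2.trans_le (min_le_right _ _)
    refine ⟨n, hn, s, hs, by linarith [h1'.2], ?_⟩
    obtain ⟨σ, hσ, hσ'⟩ := exists_coe_eq_abs_eq_norm (Q • (s • x n - z.1 (i₀ + i)))
    refine ⟨r / 2 ^ i + σ, ?_, ?_⟩
    · rw [AddCircle.coe_add, hσ, ← hQr i, smul_sub, mul_smul]; abel
    · have f1 : |σ| ≤ 1 / 2 ^ i := by
        rw [hσ']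
        refine norm_nsmul_le.trans ?_
        calc (Q : ℝ) * ‖s • x n - z.1 (i₀ + i)‖ ≤ Q * (1 / (Q * 2 ^ i)) := by gcongr
          _ = 1 / 2 ^ i := by field_simp
      calc |r / 2 ^ i + σ| ≤ |r / 2 ^ i| + |σ| := abs_add_le _ _
        _ ≤ |r| / 2 ^ i + 1 / 2 ^ i := by
            rw [abs_div, abs_of_pos (by positivity : (0 : ℝ) < 2 ^ i)]; gcongr
        _ = C * (t / 2) := by rw [hC, ht]; field_simp; ring
        _ ≤ C * (s * y n) := by gcongr; linarith [h1'.1]) hH hδ0 v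
  have p1 : 0 < C * H := by positivity
  refine ⟨n, s, hs, ?_, ?_⟩
  · rw [abs_lt]; constructor <;> nlinarith
  · refine h3.trans_lt ?_
    nlinarith

theorem dense_scale_of_no_leaf (hy : ∀ n, 0 < y n) (hy0 : Tendsto y atTop (𝓝 0))
    (hleaf : ∀ z ∈ scaleHistorySet x y, 0 < z.2 → ¬ IsLeaf z.1) {H : ℝ} (hH : 0 < H)
    (v : UnitAddCircle) {ε : ℝ} (hε : 0 < ε) :
    ∃ n s : ℕ, IsSmooth235 s ∧ |s * y n - H| < ε ∧ ‖s • x n - v‖ < ε := by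
  obtain ⟨j, hj⟩ := exists_nat_gt (2 / ε)
  -- This `q` is prime to `30`, and `15 * j + 1` is an inverse of `2` modulo `q`; its powers over
  -- `q` form a halving sequence periodic under `2`, `3` and `5`.
  set q : ℕ := 30 * j + 1 with hq
  have hq0 : 0 < q := by omega
  have hqε : (1 : ℝ) / q < ε / 2 := by
    rw [div_lt_iff₀ hε] at hj
    rw [div_lt_iff₀ (by positivity), hq]
    push_cast
    nlinarith
  set K := Nat.totient q
  have hK : 0 < K := Nat.totient_pos.mpr hq0
  have cop : ∀ {m k l : ℕ}, m * k = l * q + 1 → m.Coprime q := by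
    intro m k l h
    refine Nat.isCoprime_iff_coprime.mp ⟨k, -l, ?_⟩
    have : (m : ℤ) * k = l * q + 1 := by exact_mod_cast h
    linarith
  have cop15 : (15 * j + 1).Coprime q := cop (k := 2) (l := 1) (by omega)
  have cop3 : Nat.Coprime 3 q := cop (k := 20 * j + 1) (l := 2) (by omega)
  have cop5 : Nat.Coprime 5 q := cop (k := 24 * j + 1) (l := 4) (by omega)
  set w : ℕ → UnitAddCircle := fun i => ((((15 * j + 1) ^ i : ℕ) / q : ℝ) : UnitAddCircle) with hw
  have hsmul : ∀ (m i : ℕ), m • w i =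
      (((m * (15 * j + 1) ^ i : ℕ) / q : ℝ) : UnitAddCircle) := by
    intro m i
    simp only [hw]
    rw [nsmul_coe]
    congr 1
    push_cast; ring
  have hwh : IsHalving w := by
    intro i
    rw [hsmul]
    refine coe_div_eq_of_modEq hq0 ?_
    have : 2 * (15 * j + 1) ^ (i + 1) = (15 * j + 1) ^ i + q * (15 * j + 1) ^ i := by
      rw [hq]; ring
    rw [this]
    simp [Nat.ModEq]
  have htot : ∀ {m : ℕ}, m.Coprime q → m ^ K • w = w := by
    intro m hm
    ext i
    rw [Pi.smul_apply, hsmul]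
    refine coe_div_eq_of_modEq hq0 ?_
    simpa using (Nat.ModEq.pow_totient hm).mul_right ((15 * j + 1) ^ i)
  have hw2 : ∀ i, w (i + K) = w i := by
    intro i
    refine coe_div_eq_of_modEq hq0 ?_
    rw [pow_add]
    simpa using (Nat.ModEq.pow_totient cop15).mul_left ((15 * j + 1) ^ i)
  obtain ⟨z, hz, hz0, htr⟩ := ((isScaleSet_scaleHistorySet (x := x) (y := y)).of_one
    K).exists_translates_mem hK hleaf (exists_mem_scaleHistorySet hy hy0) hwh (htot cop3)
    (htot cop5) hw2 q
  obtain ⟨T₀, hT₀, hT⟩ := exists_pow_mul_pow_near (g := 3) (h := 5) (by norm_num) (by norm_num)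
    (by norm_num) one_pos (by positivity : 0 < ε / (2 * H))
  -- The scale is first halved `e` times, then raised to about `H` by `s = 3 ^ b * 5 ^ c`. As `s` is
  -- prime to `q`, the translates remain `1 / q`-dense.
  obtain ⟨e, he⟩ := pow_unbounded_of_one_lt (T₀ * z.2 / H) (one_lt_two : (1 : ℝ) < 2)
  set t : ℝ := z.2 / 2 ^ e with ht
  have ht0 : 0 < t := by positivity
  have hTt : H / t ≥ T₀ := by
    rw [ge_iff_le, le_div_iff₀ ht0, ht, ← mul_div_assoc, div_le_iff₀ (by positivity)]
    rw [div_lt_iff₀ hH] at he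
    linarith
  obtain ⟨b, c, -, -, h1, h2⟩ := hT _ hTt 0
  set s := 3 ^ b * 5 ^ c with hs
  have hs' : IsSmooth235 s := (IsSmooth235.three.pow b).mul (IsSmooth235.five.pow c)
  have hsr : ((3 : ℕ) : ℝ) ^ b * ((5 : ℕ) : ℝ) ^ c = (s : ℝ) := by rw [hs]; push_cast; ring
  rw [hsr, div_le_iff₀ ht0] at h1
  rw [hsr, div_mul_eq_mul_div, le_div_iff₀ ht0] at h2
  have hHε : H * (1 + ε / (2 * H)) = H + ε / 2 := by field_simp
  rw [hHε] at h2
  have cops : (s * (15 * j + 1) ^ e).Coprime q :=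
    ((cop3.pow_left b).mul_left (cop5.pow_left c)).mul_left (cop15.pow_left e)
  obtain ⟨i, hi, hin⟩ := exists_le_nsmul_near hq0 cops (v - s • z.1 e)
  rw [← hsmul] at hin
  have hmem := smul_mem_scaleLimitSet ((htr i hi).2 e) hs'
  obtain ⟨n, -, s', hs'', k1, k2⟩ := exists_near_of_mem_scaleLimitSet hmem 0
    (by positivity : 0 < ε / 2)
  refine ⟨n, s' , hs'', ?_, ?_⟩
  · change |s' * y n - s * t| < ε / 2 at k1
    have := abs_lt.mp k1
    rw [abs_lt]; constructor <;> linarith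
  · simp only [Pi.add_apply, Pi.smul_apply] at k2
    have e1 : s' • x n - v = (s' • x n - s • (z.1 e + i • w e)) +
        (i • s • w e - (v - s • z.1 e)) := by
      rw [smul_add, smul_comm s i]; abel
    rw [e1]
    refine (norm_add_le _ _).trans_lt ?_
    linarith

end scaleLimitSet

/-- The core density statement: if `x n` converges to a non-torsion point while the positive scales
`y n` tend to `0`, then, for some `Q`, the points `(Q s x n, s y n)` are dense in
the half-cylinder. -/
theorem dense_scale {x : ℕ → UnitAddCircle} {y : ℕ → ℝ} {x' : UnitAddCircle}
    (hx : Tendsto x atTop (𝓝 x')) (hx' : ∀ M : ℕ, 0 < M → M • x' ≠ 0) (hy : ∀ n, 0 < y n)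
    (hy0 : Tendsto y atTop (𝓝 0)) :
    ∃ Q : ℕ, 0 < Q ∧ ∀ H > 0, ∀ v : UnitAddCircle, ∀ ε > 0, ∃ n s : ℕ, IsSmooth235 s ∧
      |s * y n - H| < ε ∧ ‖(Q * s) • x n - v‖ < ε := by
  by_cases h : ∃ z ∈ scaleHistorySet x y, 0 < z.2 ∧ IsLeaf z.1
  · obtain ⟨z, hz, hz0, hl⟩ := h
    exact dense_scale_of_leaf hx hx' hy hy0 hz hz0 hl
  · push Not at h
    refine ⟨1, one_pos, fun H hH v ε hε => ?_⟩
    simpa using dense_scale_of_no_leaf hy hy0 h hH v hε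

/-! ### Orbits on the torus, and accumulation at points `(u', 0)`. -/

theorem iterate_timesMap (k a : ℕ) (p : TorusTwo) : (timesMap k)^[a] p = k ^ a • p := by
  induction a with
  | zero => simp
  | succ a ih =>
    rw [Function.iterate_succ_apply', ih, pow_succ', mul_smul]
    rfl

theorem mem_orbit235_iff {p q : TorusTwo} :
    q ∈ orbit235 p ↔ ∃ s : ℕ, IsSmooth235 s ∧ q = s • p := by
  constructor
  · rintro ⟨a, b, c, rfl⟩
    refine ⟨_, ⟨a, b, c, rfl⟩, ?_⟩
    simp only [iterate_timesMap, smul_smul, mul_assoc]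
  · rintro ⟨_, ⟨a, b, c, rfl⟩, rfl⟩
    refine ⟨a, b, c, ?_⟩
    simp only [iterate_timesMap, smul_smul, mul_assoc]

theorem smul_mem_closure_orbit235 {p q : TorusTwo} (hq : q ∈ closure (orbit235 p)) {s : ℕ}
    (hs : IsSmooth235 s) : s • q ∈ closure (orbit235 p) := by
  refine map_mem_closure (f := fun q : TorusTwo => s • q) (by fun_prop) hq fun r hr => ?_
  obtain ⟨t, ht, rfl⟩ := mem_orbit235_iff.mp hr
  exact mem_orbit235_iff.mpr ⟨s * t, hs.mul ht, by rw [mul_smul]⟩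

theorem Dense.orbit235_map {p : TorusTwo} (h : Dense (orbit235 p)) (f : TorusTwo →+ TorusTwo)
    (hf : Continuous f) (hsurj : Function.Surjective f) : Dense (orbit235 (f p)) := by
  refine (hsurj.denseRange.dense_image hf h).mono ?_
  rintro _ ⟨q, hq, rfl⟩
  obtain ⟨s, hs, rfl⟩ := mem_orbit235_iff.mp hq
  exact mem_orbit235_iff.mpr ⟨s, hs, map_nsmul f s p⟩

theorem exists_nsmul_eq_of_norm {n : ℕ} (hn : 0 < n) (w : UnitAddCircle) :
    ∃ d : UnitAddCircle, n • d = w ∧ ‖d‖ ≤ 1 / n := by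
  obtain ⟨ρ, hρ, hρ'⟩ := exists_coe_eq_abs_eq_norm w
  have hn' : (0 : ℝ) < n := by exact_mod_cast hn
  refine ⟨((ρ / n : ℝ) : UnitAddCircle), ?_, ?_⟩
  · rw [nsmul_coe, mul_div_cancel₀ _ hn'.ne', hρ]
  · refine (norm_coe_le_abs _).trans ?_
    rw [abs_div, abs_of_pos hn', hρ']
    gcongr
    have := AddCircle.norm_le_half_period (1 : ℝ) (x := w) one_ne_zero
    norm_num at this
    linarith

/-- Density of the orbit of a multiple of a point implies density of the orbit of the point. -/
theorem dense_orbit235_of_nsmul {p : TorusTwo} {M : ℕ} (hM : 0 < M)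
    (h : Dense (orbit235 (M • p))) : Dense (orbit235 p) := by
  set X := closure (orbit235 p) with hX
  have hXc : IsClosed X := isClosed_closure
  have himage : ∀ q : TorusTwo, ∃ ξ ∈ X, M • ξ = M • q := by
    have hcl : IsClosed ((fun q : TorusTwo => M • q) '' X) :=
      (hXc.isCompact.image (by fun_prop)).isClosed
    intro q
    have hsub : closure (orbit235 (M • p)) ⊆ (fun q : TorusTwo => M • q) '' X := by
      refine closure_minimal ?_ hcl
      intro r hr
      obtain ⟨s, hs, rfl⟩ := mem_orbit235_iff.mp hr
      exact ⟨s • p, subset_closure (mem_orbit235_iff.mpr ⟨s, hs, rfl⟩), smul_comm _ _ _⟩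
    exact hsub (h (M • q))
  set τ : ℤ × ℤ → TorusTwo := fun i =>
    (((i.1 / M : ℝ) : UnitAddCircle), ((i.2 / M : ℝ) : UnitAddCircle)) with hτ
  -- Translates of `X` by `M`-torsion points cover the torus, so by Baire one of them contains a
  -- ball. Multiplication by `2 ^ k` spreads the corresponding ball of `X` over the torus.
  have hcover : ⋃ i : ℤ × ℤ, {q : TorusTwo | q - τ i ∈ X} = Set.univ := by
    refine Set.eq_univ_of_forall fun q => ?_
    obtain ⟨ξ, hξ, hMξ⟩ := himage q
    have h1 : M • (q.1 - ξ.1) = ((0 : ℝ) : UnitAddCircle) := by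
      rw [smul_sub, AddCircle.coe_zero, sub_eq_zero]
      exact (congrArg Prod.fst hMξ).symm
    have h2 : M • (q.2 - ξ.2) = ((0 : ℝ) : UnitAddCircle) := by
      rw [smul_sub, AddCircle.coe_zero, sub_eq_zero]
      exact (congrArg Prod.snd hMξ).symm
    obtain ⟨i, hi⟩ := exists_eq_coe_div_of_nsmul_eq hM h1
    obtain ⟨j, hj⟩ := exists_eq_coe_div_of_nsmul_eq hM h2
    rw [zero_add] at hi hj
    refine Set.mem_iUnion.mpr ⟨(i, j), ?_⟩
    have : q - τ (i, j) = ξ := by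
      simp only [hτ, ← hi, ← hj]
      ext <;> simp
    change q - τ (i, j) ∈ X
    rwa [this]
  obtain ⟨i, ξ, hξ⟩ := nonempty_interior_of_iUnion_of_closed
    (fun i => hXc.preimage (f := fun q : TorusTwo => q - τ i) (by fun_prop)) hcover
  obtain ⟨r, hr, hball⟩ := Metric.isOpen_iff.mp isOpen_interior ξ hξ
  obtain ⟨k, hk⟩ := pow_unbounded_of_one_lt (1 / r) (one_lt_two : (1 : ℝ) < 2)
  have hkr : (1 : ℝ) / (2 ^ k : ℕ) < r := by
    push_cast
    rw [div_lt_comm₀ (by positivity) hr]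
    exact hk
  intro v
  obtain ⟨d₁, h1, h1'⟩ := exists_nsmul_eq_of_norm (n := 2 ^ k) (by positivity)
    (v.1 - 2 ^ k • (ξ - τ i).1)
  obtain ⟨d₂, h2, h2'⟩ := exists_nsmul_eq_of_norm (n := 2 ^ k) (by positivity)
    (v.2 - 2 ^ k • (ξ - τ i).2)
  have hmem : ξ + (d₁, d₂) - τ i ∈ X := by
    have : ξ + (d₁, d₂) ∈ Metric.ball ξ r := by
      rw [mem_ball_iff_norm, add_sub_cancel_left, Prod.norm_def, max_lt_iff]
      exact ⟨h1'.trans_lt hkr, h2'.trans_lt hkr⟩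
    exact interior_subset (s := {q : TorusTwo | q - τ i ∈ X}) (hball this)
  have := smul_mem_closure_orbit235 hmem (IsSmooth235.two.pow k)
  have e : 2 ^ k • (ξ + (d₁, d₂) - τ i) = v := by
    rw [add_sub_right_comm, smul_add]
    ext
    · simp [h1]
    · simp [h2]
  rwa [e] at this

/-- The endomorphism `(a, b) ↦ (A a, B b + C a)` of the torus. -/
def triangularMap (A B C : ℤ) : TorusTwo →+ TorusTwo where
  toFun p := (A • p.1, B • p.2 + C • p.1)
  map_zero' := by simp
  map_add' p q := by ext <;> simp [smul_add]; abel

theorem continuous_triangularMap (A B C : ℤ) : Continuous (triangularMap A B C) := by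
  change Continuous fun p : TorusTwo => ((A • p.1, B • p.2 + C • p.1) : TorusTwo)
  fun_prop

theorem zsmul_surjective {A : ℤ} (hA : A ≠ 0) (w : UnitAddCircle) : ∃ d : UnitAddCircle,
    A • d = w := by
  obtain ⟨θ, rfl⟩ := QuotientAddGroup.mk_surjective w
  refine ⟨((θ / A : ℝ) : UnitAddCircle), ?_⟩
  have hA' : (A : ℝ) ≠ 0 := by exact_mod_cast hA
  rw [← AddCircle.coe_zsmul, zsmul_eq_mul, mul_div_cancel₀ _ hA']

theorem surjective_triangularMap {A B : ℤ} (hA : A ≠ 0) (hB : B ≠ 0) (C : ℤ) :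
    Function.Surjective (triangularMap A B C) := by
  intro p
  obtain ⟨a, ha⟩ := zsmul_surjective hA p.1
  obtain ⟨b, hb⟩ := zsmul_surjective hB (p.2 - C • a)
  refine ⟨(a, b), ?_⟩
  change (A • a, B • b + C • a) = p
  rw [ha, hb, sub_add_cancel]

theorem Dense.orbit235_triangular {u v : UnitAddCircle}
    (h : Dense (orbit235 ((u, v) : TorusTwo))) {A B : ℤ} (hA : A ≠ 0) (hB : B ≠ 0) (C : ℤ) :
    Dense (orbit235 ((A • u, B • v + C • u) : TorusTwo)) :=
  h.orbit235_map (triangularMap A B C) (continuous_triangularMap A B C)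
    (surjective_triangularMap hA hB C)

theorem Dense.orbit235_swap {u v : UnitAddCircle}
    (h : Dense (orbit235 ((u, v) : TorusTwo))) : Dense (orbit235 ((v, u) : TorusTwo)) :=
  h.orbit235_map (AddEquiv.prodComm (M := UnitAddCircle) (N := UnitAddCircle)).toAddMonoidHom
    continuous_swap Prod.swap_surjective

theorem dense_orbit235_of_pos_scale {u v u' : UnitAddCircle} (hu' : ∀ M : ℕ, 0 < M → M • u' ≠ 0)
    {s : ℕ → ℕ} (hs : ∀ n, IsSmooth235 (s n)) (hu : Tendsto (fun n => s n • u) atTop (𝓝 u'))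
    {y : ℕ → ℝ} (hy : ∀ n, 0 < y n) (hy0 : Tendsto y atTop (𝓝 0))
    (hv : ∀ n, (y n : UnitAddCircle) = s n • v) : Dense (orbit235 ((u, v) : TorusTwo)) := by
  obtain ⟨Q, hQ, hd⟩ := dense_scale hu hu' hy hy0
  have hQz : (Q : ℤ) ≠ 0 := by exact_mod_cast hQ.ne'
  have h1 : Dense (orbit235 ((Q • u, v) : TorusTwo)) := by
    intro p
    refine Metric.mem_closure_iff.mpr fun ε hε => ?_
    obtain ⟨θ, hθ⟩ := QuotientAddGroup.mk_surjective p.2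
    -- A strictly positive representative is needed, because only positive scales are reached.
    have hθ' : ((Int.fract θ + 1 : ℝ) : UnitAddCircle) = p.2 := by
      rw [← hθ, Int.fract, sub_add, AddCircle.coe_sub]
      have := coe_intCast_eq_zero (⌊θ⌋ - 1)
      push_cast at this
      rw [this, sub_zero]
    obtain ⟨n, t, ht, k1, k2⟩ := hd (Int.fract θ + 1) (by have := Int.fract_nonneg θ; linarith)
      p.1 ε hε
    refine ⟨(t * s n) • ((Q • u, v) : TorusTwo),
      mem_orbit235_iff.mpr ⟨_, ht.mul (hs n), rfl⟩, ?_⟩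
    rw [dist_comm, Prod.dist_eq, max_lt_iff, dist_eq_norm, dist_eq_norm]
    constructor
    · have e : (t * s n) • Q • u = (Q * t) • s n • u := by
        rw [smul_smul, smul_smul]; congr 1; ring
      change ‖(t * s n) • Q • u - p.1‖ < ε
      rwa [e]
    · refine lt_of_le_of_lt ?_ k1
      change ‖(t * s n) • v - p.2‖ ≤ _
      rw [mul_smul, ← hv, nsmul_coe, ← hθ', ← AddCircle.coe_sub]
      exact norm_coe_le_abs _
  refine dense_orbit235_of_nsmul hQ ?_
  have := h1.orbit235_triangular one_ne_zero hQz 0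
  simpa using this

/-- If the orbit of `(u, v)` accumulates at `(u', 0)` with `u'` of infinite order and `v` has
infinite order, then the orbit is dense. -/
theorem dense_orbit235_of_mem_closure {u v u' : UnitAddCircle} (hv : ∀ M : ℕ, 0 < M → M • v ≠ 0)
    (hu' : ∀ M : ℕ, 0 < M → M • u' ≠ 0)
    (h : ((u', 0) : TorusTwo) ∈ closure (orbit235 ((u, v) : TorusTwo))) :
    Dense (orbit235 ((u, v) : TorusTwo)) := by
  obtain ⟨p, hp, hlim⟩ := mem_closure_iff_seq_limit.mp h
  choose s hs hps using fun n => mem_orbit235_iff.mp (hp n)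
  choose y hy hy' using fun n => exists_coe_eq_abs_eq_norm (s n • v)
  have hu : Tendsto (fun n => s n • u) atTop (𝓝 u') := by
    refine ((continuous_fst.tendsto _).comp hlim).congr fun n => ?_
    simp [hps n]
  have hy0 : Tendsto y atTop (𝓝 0) := by
    refine squeeze_zero_norm (a := fun n => ‖s n • v‖) (fun n => (hy' n).le) ?_
    have h1 : Tendsto (fun n => s n • v) atTop (𝓝 0) := by
      refine ((continuous_snd.tendsto _).comp hlim).congr fun n => ?_
      simp [hps n]
    simpa using h1.norm
  have hyne : ∀ n, y n ≠ 0 := fun n h0 => hv _ (hs n).pos (by rw [← hy n, h0, AddCircle.coe_zero])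
  have hfreq : (∃ᶠ n in atTop, 0 < y n) ∨ ∃ᶠ n in atTop, y n < 0 := by
    rw [← frequently_or_distrib]
    exact Frequently.of_forall fun n => (hyne n).lt_or_gt.symm
  rcases hfreq with hf | hf
  · obtain ⟨φ, hφ, hφy⟩ := extraction_of_frequently_atTop hf
    exact dense_orbit235_of_pos_scale hu' (fun n => hs (φ n)) (hu.comp hφ.tendsto_atTop)
      hφy (hy0.comp hφ.tendsto_atTop) (fun n => hy _)
  · obtain ⟨φ, hφ, hφy⟩ := extraction_of_frequently_atTop hf
    have h1 : Dense (orbit235 ((u, -v) : TorusTwo)) := by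
      refine dense_orbit235_of_pos_scale hu' (fun n => hs (φ n)) (hu.comp hφ.tendsto_atTop)
        (y := fun n => -y (φ n)) (fun n => neg_pos.mpr (hφy n)) ?_ (fun n => ?_)
      · simpa using (hy0.comp hφ.tendsto_atTop).neg
      · rw [AddCircle.coe_neg, hy, smul_neg]
    have := h1.orbit235_triangular (A := 1) (B := -1) one_ne_zero (by norm_num) 0
    simpa using this

/-! ### Torsion points in closed invariant subsets of the circle. -/

/-- In a non-empty closed subset of the circle without torsion points which is invariant under
multiplication by `2 ^ K` and `3 ^ K`, every translation is realised by a pair of points. -/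
theorem exists_add_mem_of_invariant {Y : Set UnitAddCircle} (hY : IsClosed Y) {K : ℕ} (hK : 0 < K)
    (h2 : ∀ z ∈ Y, 2 ^ K • z ∈ Y) (h3 : ∀ z ∈ Y, 3 ^ K • z ∈ Y) (hne : Y.Nonempty)
    (htor : ∀ z ∈ Y, ∀ M : ℕ, 0 < M → M • z ≠ 0) (t : UnitAddCircle) :
    ∃ z ∈ Y, z + t ∈ Y := by
  have h2' : ∀ {b : ℕ}, K ∣ b → ∀ z ∈ Y, 2 ^ b • z ∈ Y := by
    rintro _ ⟨b, rfl⟩ z hz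
    induction b with
    | zero => simpa using hz
    | succ b ih => rw [mul_add, mul_one, pow_add, mul_comm, mul_smul]; exact h2 _ ih
  have h3' : ∀ {b : ℕ}, K ∣ b → ∀ z ∈ Y, 3 ^ b • z ∈ Y := by
    rintro _ ⟨b, rfl⟩ z hz
    induction b with
    | zero => simpa using hz
    | succ b ih => rw [mul_add, mul_one, pow_add, mul_comm, mul_smul]; exact h3 _ ih
  have hcl : IsClosed ((fun p : UnitAddCircle × UnitAddCircle => p.1 - p.2) '' (Y ×ˢ Y)) :=
    ((hY.isCompact.prod hY.isCompact).image (by fun_prop)).isClosed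
  suffices t ∈ (fun p : UnitAddCircle × UnitAddCircle => p.1 - p.2) '' (Y ×ˢ Y) by
    obtain ⟨⟨a, b⟩, ⟨ha, hb⟩, rfl⟩ := this
    exact ⟨b, hb, by simpa using ha⟩
  rw [← hcl.closure_eq]
  refine Metric.mem_closure_iff.mpr fun ε hε => ?_
  obtain ⟨T₀, hT₀, hT⟩ := exists_pow_mul_pow_near (g := 2) (h := 3) (by norm_num) (by norm_num)
    (by norm_num) hK (by positivity : 0 < ε / 4)
  have hT₀p : 0 < T₀ := by linarith
  obtain ⟨z, hz⟩ := hne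
  obtain ⟨i, j, hij, hd⟩ := exists_lt_norm_sub_lt (fun j => 2 ^ (K * j) • z)
    (by positivity : 0 < 1 / T₀)
  obtain ⟨ρ, hρ, hρ'⟩ := exists_coe_eq_abs_eq_norm (2 ^ (K * i) • z - 2 ^ (K * j) • z)
  have hpow : 2 ^ (K * i) < 2 ^ (K * j) :=
    Nat.pow_lt_pow_right (by norm_num) (Nat.mul_lt_mul_of_pos_left hij hK)
  have hρ0 : ρ ≠ 0 := by
    intro h0
    rw [h0, AddCircle.coe_zero] at hρ
    refine htor z hz (2 ^ (K * j) - 2 ^ (K * i)) (by omega) ?_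
    rw [sub_nsmul _ hpow.le, ← sub_eq_add_neg, ← neg_sub, ← hρ, neg_zero]
  have hρT : |ρ| < 1 / T₀ := by rw [hρ']; exact hd
  -- A representative of `t` with the sign of `ρ` and `|θ| ≥ 1` makes `θ / ρ` a positive target
  -- beyond `T₀`; `|θ| ≤ 2` bounds the final error.
  obtain ⟨θ, hθt, hθ1, hθ2, hθρ⟩ : ∃ θ : ℝ, (θ : UnitAddCircle) = t ∧ 1 ≤ |θ| ∧ |θ| ≤ 2 ∧
      0 < θ / ρ := by
    obtain ⟨θ, rfl⟩ := QuotientAddGroup.mk_surjective t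
    have hshift : ∀ m : ℤ, ((θ + m : ℝ) : UnitAddCircle) = (θ : UnitAddCircle) := fun m => by
      rw [AddCircle.coe_add, coe_intCast_eq_zero, add_zero]
    have f1 := Int.floor_le θ
    have f2 := Int.lt_floor_add_one θ
    rcases hρ0.lt_or_gt with hneg | hpos
    · have e : θ + ((-⌊θ⌋ - 2 : ℤ) : ℝ) < 0 := by push_cast; linarith
      refine ⟨_, hshift (-⌊θ⌋ - 2), ?_, ?_, div_pos_of_neg_of_neg e hneg⟩
      · rw [abs_of_neg e]; push_cast; linarith
      · rw [abs_of_neg e]; push_cast; linarith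
    · have e : 0 < θ + ((-⌊θ⌋ + 1 : ℤ) : ℝ) := by push_cast; linarith
      refine ⟨_, hshift (-⌊θ⌋ + 1), ?_, ?_, div_pos e hpos⟩
      · rw [abs_of_pos e]; push_cast; linarith
      · rw [abs_of_pos e]; push_cast; linarith
  have hTθ : θ / ρ ≥ T₀ := by
    rw [← abs_of_pos hθρ, abs_div, ge_iff_le, le_div_iff₀ (abs_pos.mpr hρ0)]
    rw [lt_div_iff₀ hT₀p] at hρT
    linarith
  obtain ⟨b, c, hb, hc, k1, k2⟩ := hT _ hTθ 0
  have hb' := (Nat.modEq_zero_iff_dvd).mp hb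
  have hmem : ∀ w ∈ Y, (2 ^ b * 3 ^ c) • w ∈ Y := fun w hw => by
    rw [mul_smul]; exact h2' hb' _ (h3' hc _ hw)
  refine ⟨_, ⟨((2 ^ b * 3 ^ c) • 2 ^ (K * i) • z, (2 ^ b * 3 ^ c) • 2 ^ (K * j) • z),
    ⟨hmem _ (h2' (dvd_mul_right _ _) _ hz), hmem _ (h2' (dvd_mul_right _ _) _ hz)⟩, rfl⟩, ?_⟩
  simp only
  rw [dist_comm, dist_eq_norm, ← smul_sub, ← hρ, nsmul_coe, ← hθt, ← AddCircle.coe_sub]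
  refine (norm_coe_le_abs _).trans_lt ?_
  push_cast at k1 k2 ⊢
  have e : (2 : ℝ) ^ b * 3 ^ c * ρ - θ = (2 ^ b * 3 ^ c - θ / ρ) * ρ := by field_simp
  rw [e, abs_mul]
  have hle : |(2 : ℝ) ^ b * 3 ^ c - θ / ρ| ≤ θ / ρ * (ε / 4) := by
    rw [abs_le]
    have : 0 < θ / ρ * (ε / 4) := by positivity
    constructor <;> linarith
  calc |(2 : ℝ) ^ b * 3 ^ c - θ / ρ| * |ρ| ≤ θ / ρ * (ε / 4) * |ρ| := by gcongr
    _ = |θ| * (ε / 4) := by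
        rw [← abs_of_pos hθρ, abs_div]
        have := abs_pos.mpr hρ0
        field_simp
    _ ≤ 2 * (ε / 4) := by gcongr
    _ < ε := by linarith

/-- Closed sets invariant under multiplication by `2` and `3` contain torsion points. -/
theorem exists_torsion_mem_of_invariant {A : Set UnitAddCircle} (hA : IsClosed A)
    (h2 : ∀ z ∈ A, 2 • z ∈ A) (h3 : ∀ z ∈ A, 3 • z ∈ A) (hne : A.Nonempty) :
    ∃ z ∈ A, ∃ M : ℕ, 0 < M ∧ M • z = 0 := by
  by_contra! htor
  suffices (0 : UnitAddCircle) ∈ A from htor 0 this 1 one_pos (by simp)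
  have hp : ∀ {p : ℕ}, (∀ z ∈ A, p • z ∈ A) → ∀ k : ℕ, ∀ z ∈ A, p ^ k • z ∈ A := by
    intro p h k z hz
    induction k with
    | zero => simpa using hz
    | succ k ih => rw [pow_succ', mul_smul]; exact h _ ih
  rw [← hA.closure_eq]
  refine Metric.mem_closure_iff.mpr fun ε hε => ?_
  obtain ⟨j, hj⟩ := exists_nat_gt (1 / ε)
  -- As `q` is prime to `6`, `1 / q` is fixed by `2 ^ K` and `3 ^ K`. Repeated translation by it
  -- inside `A` comes within `1 / q` of `0`.
  set q : ℕ := 6 * j + 1 with hq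
  have hq0 : 0 < q := by omega
  have hqε : (1 : ℝ) / q < ε := by
    rw [div_lt_iff₀ hε] at hj
    rw [div_lt_iff₀ (by positivity), hq]
    push_cast
    nlinarith
  have cop2 : Nat.Coprime 2 q :=
    Nat.isCoprime_iff_coprime.mp ⟨-(3 * j), 1, by rw [hq]; push_cast; ring⟩
  have cop3 : Nat.Coprime 3 q :=
    Nat.isCoprime_iff_coprime.mp ⟨-(2 * j), 1, by rw [hq]; push_cast; ring⟩
  set K := Nat.totient q
  have hK : 0 < K := Nat.totient_pos.mpr hq0
  set t : UnitAddCircle := ((((1 : ℕ) : ℝ) / q : ℝ) : UnitAddCircle) with ht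
  have htot : ∀ {m : ℕ}, m.Coprime q → m ^ K • t = t := by
    intro m hm
    have := coe_div_eq_of_modEq hq0 (Nat.ModEq.pow_totient hm)
    rw [ht, nsmul_coe, ← this]
    congr 1
    push_cast; ring
  have key : ∀ n : ℕ, ∃ Y : Set UnitAddCircle, IsClosed Y ∧ Y ⊆ A ∧ Y.Nonempty ∧
      (∀ z ∈ Y, 2 ^ K • z ∈ Y) ∧ (∀ z ∈ Y, 3 ^ K • z ∈ Y) ∧
      ∀ z ∈ Y, ∀ i ≤ n, z + i • t ∈ A := by
    intro n
    induction n with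
    | zero =>
      refine ⟨A, hA, le_rfl, hne, hp h2 K, hp h3 K, fun z hz i hi => ?_⟩
      obtain rfl : i = 0 := by omega
      simpa using hz
    | succ n ih =>
      obtain ⟨Y, hY, hYA, hYne, hY2, hY3, hYt⟩ := ih
      obtain ⟨z, hz, hzt⟩ := exists_add_mem_of_invariant hY hK hY2 hY3 hYne
        (fun z hz => htor z (hYA hz)) t
      refine ⟨Y ∩ {z | z + t ∈ Y}, hY.inter (hY.preimage (by fun_prop)), fun z hz => hYA hz.1,
        ⟨z, hz, hzt⟩, fun z hz => ⟨hY2 z hz.1, ?_⟩, fun z hz => ⟨hY3 z hz.1, ?_⟩,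
        fun z hz i hi => ?_⟩
      · have := hY2 _ hz.2
        rwa [smul_add, htot cop2] at this
      · have := hY3 _ hz.2
        rwa [smul_add, htot cop3] at this
      · rcases Nat.eq_zero_or_pos i with rfl | hi0
        · simpa using hYA hz.1
        · obtain ⟨j, rfl⟩ : ∃ j, i = j + 1 := ⟨i - 1, by omega⟩
          rw [succ_nsmul', ← add_assoc]
          exact hYt _ hz.2 j (by omega)
  obtain ⟨Y, -, -, ⟨z, hz⟩, -, -, hYt⟩ := key q
  obtain ⟨i, hi, hin⟩ := exists_le_nsmul_near hq0 (Nat.coprime_one_left q) (-z)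
  refine ⟨_, hYt z hz i hi, ?_⟩
  rw [dist_comm, dist_eq_norm, sub_zero, add_comm, ← sub_neg_eq_add]
  exact hin.trans_lt hqε

/-! ### Independent coordinates and accumulation at the origin. -/

theorem irrational_iff_nsmul_ne_zero {θ : ℝ} :
    Irrational θ ↔ ∀ M : ℕ, 0 < M → M • (θ : UnitAddCircle) ≠ 0 := by
  constructor
  · intro h M hM h0
    rw [nsmul_coe, AddCircle.coe_eq_zero_iff] at h0
    obtain ⟨n, hn⟩ := h0
    simp only [zsmul_eq_mul, mul_one] at hn
    exact ((irrational_natCast_mul_iff.mpr ⟨hM.ne', h⟩).ne_int n) hn.symm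
  · rintro h ⟨r, rfl⟩
    refine h r.den r.den_pos ?_
    rw [nsmul_coe]
    have : (r.den : ℝ) * r = (r.num : ℝ) := by exact_mod_cast Rat.den_mul_eq_num r
    rw [this, coe_intCast_eq_zero]

/-- The pair `(u, v)` generates a free subgroup of rank two of the circle. -/
def IsIndependent (u v : UnitAddCircle) : Prop :=
  ∀ m n : ℤ, m • u + n • v = 0 → m = 0 ∧ n = 0

namespace IsIndependent

variable {u v : UnitAddCircle}

theorem left (h : IsIndependent u v) (M : ℕ) (hM : 0 < M) : M • u ≠ 0 := fun h0 => by
  have := (h M 0 (by simpa using h0)).1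
  omega

theorem swap (h : IsIndependent u v) : IsIndependent v u := fun m n hmn =>
  (h n m (by rwa [add_comm])).symm

theorem right (h : IsIndependent u v) (M : ℕ) (hM : 0 < M) : M • v ≠ 0 := h.swap.left M hM

theorem nsmul (h : IsIndependent u v) {M : ℕ} (hM : 0 < M) : IsIndependent (M • u) (M • v) := by
  intro m n hmn
  have := h (m * M) (n * M) (by rw [mul_smul, mul_smul, natCast_zsmul, natCast_zsmul]; exact hmn)
  simpa [hM.ne'] using this

theorem neg (h : IsIndependent u v) : IsIndependent (-u) (-v) := by
  intro m n hmn
  simpa using h (-m) (-n) (by simpa using hmn)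

end IsIndependent

/-- Near the origin `s n • (u, v)` looks like `r n * (1, ρ)`. A multiplier `2 ^ b * 3 ^ c` close to
`H / r n` carries it near `H * (1, ρ)`. -/
theorem mem_closure_orbit235_of_direction {u v : UnitAddCircle} {s : ℕ → ℕ}
    (hs : ∀ n, IsSmooth235 (s n)) {r t : ℕ → ℝ} (hr : ∀ n, (r n : UnitAddCircle) = s n • u)
    (ht : ∀ n, (t n : UnitAddCircle) = s n • v) (hr0 : ∀ n, 0 < r n)
    (hrlim : Tendsto r atTop (𝓝 0)) {ρ : ℝ} (hρ : Tendsto (fun n => t n / r n) atTop (𝓝 ρ))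
    {H : ℝ} (hH : 0 < H) :
    (((H : UnitAddCircle), ((H * ρ : ℝ) : UnitAddCircle)) : TorusTwo) ∈
      closure (orbit235 ((u, v) : TorusTwo)) := by
  refine Metric.mem_closure_iff.mpr fun ε hε => ?_
  set δ : ℝ := min 1 (ε / (2 * (H * (3 + |ρ|)))) with hδ
  have hδ0 : 0 < δ := by positivity
  have hδ1 : δ ≤ 1 := min_le_left _ _
  have hδε : H * (3 + |ρ|) * δ ≤ ε / 2 := by
    calc H * (3 + |ρ|) * δ ≤ H * (3 + |ρ|) * (ε / (2 * (H * (3 + |ρ|)))) := by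
          gcongr; exact min_le_right _ _
      _ = ε / 2 := by field_simp
  obtain ⟨T₀, hT₀, hT⟩ := exists_pow_mul_pow_near (g := 2) (h := 3) (by norm_num) (by norm_num)
    (by norm_num) one_pos hδ0
  have hT₀p : 0 < T₀ := by linarith
  obtain ⟨n, h1, h2⟩ := ((hrlim.eventually (gt_mem_nhds (by positivity : 0 < H / T₀))).and
    (Metric.tendsto_nhds.mp hρ δ hδ0)).exists
  have hrn := hr0 n
  have hTn : H / r n ≥ T₀ := by
    rw [ge_iff_le, le_div_iff₀ hrn]
    rw [lt_div_iff₀ hT₀p] at h1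
    linarith
  obtain ⟨b, c, -, -, k1, k2⟩ := hT _ hTn 0
  set m : ℕ := 2 ^ b * 3 ^ c with hm
  have hmr : ((2 : ℕ) : ℝ) ^ b * ((3 : ℕ) : ℝ) ^ c = (m : ℝ) := by rw [hm]; push_cast; ring
  rw [hmr, div_le_iff₀ hrn] at k1
  rw [hmr, div_mul_eq_mul_div, le_div_iff₀ hrn] at k2
  refine ⟨(m * s n) • ((u, v) : TorusTwo), mem_orbit235_iff.mpr
    ⟨_, ((IsSmooth235.two.pow b).mul (IsSmooth235.three.pow c)).mul (hs n), rfl⟩, ?_⟩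
  have hmrH : |m * r n - H| ≤ H * δ := by rw [abs_le]; constructor <;> nlinarith
  rw [dist_comm, Prod.dist_eq, max_lt_iff, dist_eq_norm, dist_eq_norm]
  have habs : 0 ≤ H * |ρ| * δ := by positivity
  have hHδ : 0 < H * δ := by positivity
  constructor
  · change ‖(m * s n) • u - (H : UnitAddCircle)‖ < ε
    rw [mul_smul, ← hr, nsmul_coe, ← AddCircle.coe_sub]
    refine (norm_coe_le_abs _).trans_lt (hmrH.trans_lt ?_)
    nlinarith
  · change ‖(m * s n) • v - ((H * ρ : ℝ) : UnitAddCircle)‖ < ε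
    rw [mul_smul, ← ht, nsmul_coe, ← AddCircle.coe_sub]
    refine (norm_coe_le_abs _).trans_lt ?_
    have e : m * t n - H * ρ = m * r n * (t n / r n - ρ) + (m * r n - H) * ρ := by
      field_simp; ring
    rw [Real.dist_eq] at h2
    have hmr0 : 0 ≤ (m : ℝ) * r n := by positivity
    rw [e]
    calc |m * r n * (t n / r n - ρ) + (m * r n - H) * ρ|
        ≤ |m * r n * (t n / r n - ρ)| + |(m * r n - H) * ρ| := abs_add_le _ _
      _ = m * r n * |t n / r n - ρ| + |m * r n - H| * |ρ| := by
          rw [abs_mul _ (t n / r n - ρ), abs_mul _ ρ, abs_of_nonneg hmr0]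
      _ ≤ (H * (1 + δ)) * δ + (H * δ) * |ρ| := by gcongr
      _ < ε := by nlinarith

theorem dense_orbit235_of_direction {u v : UnitAddCircle} (huv : IsIndependent u v) {s : ℕ → ℕ}
    (hs : ∀ n, IsSmooth235 (s n)) {r t : ℕ → ℝ} (hr : ∀ n, (r n : UnitAddCircle) = s n • u)
    (ht : ∀ n, (t n : UnitAddCircle) = s n • v) (hr0 : ∀ n, 0 < r n)
    (hrlim : Tendsto r atTop (𝓝 0)) {ρ : ℝ} (hρ : Tendsto (fun n => t n / r n) atTop (𝓝 ρ)) :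
    Dense (orbit235 ((u, v) : TorusTwo)) := by
  by_cases hirr : Irrational ρ
  · have hρ0 : ρ ≠ 0 := hirr.ne_zero
    -- At `H = |ρ|⁻¹` the second coordinate is `±1`, hence zero on the circle, while the first is
    -- irrational.
    have hmem := mem_closure_orbit235_of_direction hs hr ht hr0 hrlim hρ
      (H := |ρ|⁻¹) (by positivity)
    have hz : ((|ρ|⁻¹ * ρ : ℝ) : UnitAddCircle) = 0 := by
      rcases hρ0.lt_or_gt with h | h
      · rw [abs_of_neg h, ← neg_inv, neg_mul, inv_mul_cancel₀ hρ0]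
        simp
      · rw [abs_of_pos h, inv_mul_cancel₀ hρ0]
        simp
    rw [hz] at hmem
    refine dense_orbit235_of_mem_closure huv.right (irrational_iff_nsmul_ne_zero.mp ?_) hmem
    have : Irrational |ρ| := by
      rcases abs_choice ρ with h | h <;> rw [h]
      · exact hirr
      · exact hirr.neg
    exact this.inv
  · obtain ⟨x, rfl⟩ : ∃ x : ℚ, (x : ℝ) = ρ := by simpa [Irrational] using hirr
    have hden : (x.den : ℤ) ≠ 0 := by exact_mod_cast x.den_nz
    have hxr : (x.den : ℝ) * x = x.num := by exact_mod_cast Rat.den_mul_eq_num x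
    -- This shear makes the slope zero, so any irrational height, here `√2`, serves. Afterwards a
    -- triangular map takes `(u, v')` to `x.den • (u, v)`.
    set v' : UnitAddCircle := (x.den : ℤ) • v + (-x.num) • u with hv'
    have hlim : Tendsto (fun n => ((x.den : ℝ) * t n - x.num * r n) / r n) atTop (𝓝 0) := by
      have := (hρ.const_mul (x.den : ℝ)).sub_const (x.num : ℝ)
      rw [hxr, sub_self] at this
      refine this.congr fun n => ?_
      have := (hr0 n).ne'
      field_simp
    have hmem := mem_closure_orbit235_of_direction (v := v')
      (t := fun n => (x.den : ℝ) * t n - x.num * r n) hs hr (fun n => by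
        have e1 : (((x.den : ℝ) * t n : ℝ) : UnitAddCircle) = (x.den : ℤ) • s n • v := by
          rw [← ht, ← AddCircle.coe_zsmul, zsmul_eq_mul]; norm_cast
        have e2 : (((x.num : ℝ) * r n : ℝ) : UnitAddCircle) = x.num • s n • u := by
          rw [← hr, ← AddCircle.coe_zsmul, zsmul_eq_mul]
        rw [AddCircle.coe_sub, e1, e2, hv', smul_add, smul_comm (s n), smul_comm (s n), neg_smul,
          sub_eq_add_neg]) hr0 hrlim hlim (H := √2) (by positivity)
    rw [mul_zero, AddCircle.coe_zero] at hmem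
    have hd := dense_orbit235_of_mem_closure (fun M hM h0 => by
      have := huv (M * -x.num) (M * x.den) (by
        rw [mul_smul, mul_smul, ← smul_add, natCast_zsmul, add_comm]
        exact h0)
      have h2 := this.2
      simp [hM.ne'] at h2) (irrational_iff_nsmul_ne_zero.mp irrational_sqrt_two) hmem
    refine dense_orbit235_of_nsmul x.den_pos ?_
    have := hd.orbit235_triangular hden one_ne_zero x.num
    convert this using 2
    ext <;> simp [hv']

/-- Swapping coordinates and changing sign, one may take `|t n| ≤ |r n|` and `0 < r n` infinitely
often; the slopes then lie in `[-1, 1]` and converge along a subsequence. -/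
theorem dense_orbit235_of_zero_mem_closure {u v : UnitAddCircle} (huv : IsIndependent u v)
    (h : (0 : TorusTwo) ∈ closure (orbit235 ((u, v) : TorusTwo))) :
    Dense (orbit235 ((u, v) : TorusTwo)) := by
  obtain ⟨p, hp, hlim⟩ := mem_closure_iff_seq_limit.mp h
  choose s hs hps using fun n => mem_orbit235_iff.mp (hp n)
  choose r hr hr' using fun n => exists_coe_eq_abs_eq_norm (s n • u)
  choose t ht ht' using fun n => exists_coe_eq_abs_eq_norm (s n • v)
  have hu0 : Tendsto (fun n => s n • u) atTop (𝓝 0) := by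
    refine ((continuous_fst.tendsto _).comp hlim).congr fun n => ?_
    simp [hps n]
  have hv0 : Tendsto (fun n => s n • v) atTop (𝓝 0) := by
    refine ((continuous_snd.tendsto _).comp hlim).congr fun n => ?_
    simp [hps n]
  have hr0 : Tendsto r atTop (𝓝 0) :=
    squeeze_zero_norm (fun n => (hr' n).le) (by simpa using hu0.norm)
  have ht0 : Tendsto t atTop (𝓝 0) :=
    squeeze_zero_norm (fun n => (ht' n).le) (by simpa using hv0.norm)
  have main : ∀ {u v : UnitAddCircle}, IsIndependent u v → ∀ {r t : ℕ → ℝ},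
      (∀ n, (r n : UnitAddCircle) = s n • u) → (∀ n, (t n : UnitAddCircle) = s n • v) →
      Tendsto r atTop (𝓝 0) → (∃ᶠ n in atTop, |t n| ≤ |r n| ∧ 0 < r n) →
      Dense (orbit235 ((u, v) : TorusTwo)) := by
    intro u v huv r t hr ht hr0 hf
    obtain ⟨φ, hφ, hφr⟩ := extraction_of_frequently_atTop hf
    obtain ⟨ρ, -, ψ, hψ, hρ⟩ := (isCompact_Icc (a := (-1 : ℝ)) (b := 1)).tendsto_subseq
      (x := fun n => t (φ n) / r (φ n)) (fun n => by
        rw [Set.mem_Icc, ← abs_le, abs_div]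
        exact div_le_one_of_le₀ (hφr n).1 (abs_nonneg _))
    exact dense_orbit235_of_direction huv (s := fun n => s (φ (ψ n))) (fun n => hs _)
      (r := fun n => r (φ (ψ n))) (t := fun n => t (φ (ψ n))) (fun n => hr _) (fun n => ht _)
      (fun n => (hφr _).2) (hr0.comp (hφ.tendsto_atTop.comp hψ.tendsto_atTop)) hρ
  have main' : ∀ {u v : UnitAddCircle}, IsIndependent u v → ∀ {r t : ℕ → ℝ},
      (∀ n, (r n : UnitAddCircle) = s n • u) → (∀ n, (t n : UnitAddCircle) = s n • v) →
      Tendsto r atTop (𝓝 0) → (∃ᶠ n in atTop, |t n| ≤ |r n|) →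
      Dense (orbit235 ((u, v) : TorusTwo)) := by
    intro u v huv r t hr ht hr0 hf
    have hne : ∀ n, r n ≠ 0 := fun n h0 =>
      huv.left _ (hs n).pos (by rw [← hr, h0, AddCircle.coe_zero])
    have hf2 : (∃ᶠ n in atTop, |t n| ≤ |r n| ∧ 0 < r n) ∨
        ∃ᶠ n in atTop, |-t n| ≤ |-r n| ∧ 0 < -r n := by
      rw [← frequently_or_distrib]
      refine hf.mono fun n hn => ?_
      rw [abs_neg, abs_neg, neg_pos]
      rcases (hne n).lt_or_gt with h | h
      · exact Or.inr ⟨hn, h⟩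
      · exact Or.inl ⟨hn, h⟩
    rcases hf2 with hf2 | hf2
    · exact main huv hr ht hr0 hf2
    · have := main huv.neg (r := fun n => -r n) (t := fun n => -t n)
        (fun n => by rw [AddCircle.coe_neg, hr, smul_neg])
        (fun n => by rw [AddCircle.coe_neg, ht, smul_neg]) (by simpa using hr0.neg) hf2
      have := this.orbit235_triangular (A := -1) (B := -1) (by norm_num) (by norm_num) 0
      simpa using this
  have hf : (∃ᶠ n in atTop, |t n| ≤ |r n|) ∨ ∃ᶠ n in atTop, |r n| ≤ |t n| := by
    rw [← frequently_or_distrib]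
    exact Frequently.of_forall fun n => le_total _ _
  rcases hf with hf | hf
  · exact main' huv hr ht hr0 hf
  · exact (main' huv.swap ht hr ht0 hf).orbit235_swap

theorem dense_orbit235_of_isIndependent {u v : UnitAddCircle} (huv : IsIndependent u v) :
    Dense (orbit235 ((u, v) : TorusTwo)) := by
  set X := closure (orbit235 ((u, v) : TorusTwo)) with hX
  have hXc : IsCompact X := isClosed_closure.isCompact
  obtain ⟨z, ⟨p, hp, rfl⟩, M, hM, hMz⟩ := exists_torsion_mem_of_invariant
    (A := Prod.snd '' X) (hXc.image continuous_snd).isClosed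
    (by rintro _ ⟨p, hp, rfl⟩; exact ⟨_, smul_mem_closure_orbit235 hp IsSmooth235.two, rfl⟩)
    (by rintro _ ⟨p, hp, rfl⟩; exact ⟨_, smul_mem_closure_orbit235 hp IsSmooth235.three, rfl⟩)
    ⟨v, (u, v), subset_closure (mem_orbit235_iff.mpr ⟨1, IsSmooth235.one, by simp⟩), rfl⟩
  have hsmul : ∀ (m : ℕ), (m • p : TorusTwo) ∈ closure (orbit235 ((m • u, m • v) : TorusTwo)) := by
    intro m
    refine map_mem_closure (f := fun q : TorusTwo => m • q) (by fun_prop) hp fun q hq => ?_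
    obtain ⟨s, hs, rfl⟩ := mem_orbit235_iff.mp hq
    exact mem_orbit235_iff.mpr ⟨s, hs, smul_comm _ _ _⟩
  -- If `p.1` has infinite order, `M • p` is a point `(u', 0)`; otherwise a further multiple of `p`
  -- is the origin.
  by_cases hp1 : ∀ L : ℕ, 0 < L → L • p.1 ≠ 0
  · refine dense_orbit235_of_nsmul hM ?_
    refine dense_orbit235_of_mem_closure (u' := M • p.1) (huv.nsmul hM).right (fun L hL => ?_) ?_
    · rw [smul_smul]
      exact hp1 _ (Nat.mul_pos hL hM)
    · have := hsmul M
      rwa [show (M • p : TorusTwo) = (M • p.1, 0) from Prod.ext rfl hMz] at this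
  · push Not at hp1
    obtain ⟨L, hL, hLp⟩ := hp1
    have hLM : 0 < L * M := Nat.mul_pos hL hM
    refine dense_orbit235_of_nsmul hLM ?_
    refine dense_orbit235_of_zero_mem_closure (huv.nsmul hLM) ?_
    have e : ((L * M) • p : TorusTwo) = 0 := by
      ext
      · change (L * M) • p.1 = 0
        rw [mul_comm, mul_smul, hLp, smul_zero]
      · change (L * M) • p.2 = 0
        rw [mul_smul, hMz, smul_zero]
    have := hsmul (L * M)
    rwa [e] at this

/-! ### Rational relations and the converse. -/

theorem isIndependent_of_not_rationallyRelated {x y : ℝ} (h : ¬ RationallyRelated x y) :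
    IsIndependent (x : UnitAddCircle) (y : UnitAddCircle) := by
  intro m n hmn
  by_contra hne
  rw [← AddCircle.coe_zsmul, ← AddCircle.coe_zsmul, ← AddCircle.coe_add,
    AddCircle.coe_eq_zero_iff] at hmn
  obtain ⟨k, hk⟩ := hmn
  simp only [zsmul_eq_mul, mul_one] at hk
  have hgpos : 0 < Int.gcd m n := Int.gcd_pos_iff.mpr (by tauto)
  have hg0 : 0 < Int.gcd (Int.gcd m n : ℤ) k := Int.gcd_pos_iff.mpr (Or.inl (by omega))
  set g := Int.gcd (Int.gcd m n : ℤ) k with hg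
  have hgg : (g : ℤ) ∣ Int.gcd m n := Int.gcd_dvd_left ..
  obtain ⟨m', hm'⟩ : (g : ℤ) ∣ m := hgg.trans (Int.gcd_dvd_left ..)
  obtain ⟨n', hn'⟩ : (g : ℤ) ∣ n := hgg.trans (Int.gcd_dvd_right ..)
  obtain ⟨k', hk'⟩ : (g : ℤ) ∣ k := Int.gcd_dvd_right ..
  refine h ⟨m', n', k', ?_, ?_⟩
  · have e : g * Int.gcd (Int.gcd m' n' : ℤ) k' = g * 1 := by
      conv_rhs => rw [mul_one, hg, hm', hn', hk', Int.gcd_mul_left, Int.natAbs_natCast]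
      rw [Nat.cast_mul, Int.gcd_mul_left, Int.natAbs_natCast]
    exact Nat.eq_of_mul_eq_mul_left hg0 e
  · have hgr : (g : ℝ) ≠ 0 := by positivity
    rw [hm', hn', hk'] at hk
    push_cast at hk
    refine mul_left_cancel₀ hgr ?_
    linarith

/-- The relation confines the orbit to the closed subgroup `m • p.1 + n • p.2 = 0`. If this were the
whole torus, divisibility of the circle would force `m = n = 0`, then `k = 0`, against the gcd
condition. -/
theorem not_dense_of_rationallyRelated {x y : ℝ} (h : RationallyRelated x y) :
    ¬ Dense (orbit235 (torusPoint x y)) := by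
  obtain ⟨m, n, k, hgcd, hk⟩ := h
  intro hd
  have hcl : IsClosed {p : TorusTwo | m • p.1 + n • p.2 = 0} :=
    isClosed_eq (by fun_prop) continuous_const
  have hsub : orbit235 (torusPoint x y) ⊆ {p : TorusTwo | m • p.1 + n • p.2 = 0} := by
    intro p hp
    obtain ⟨s, -, rfl⟩ := mem_orbit235_iff.mp hp
    change m • s • (x : UnitAddCircle) + n • s • (y : UnitAddCircle) = 0
    rw [smul_comm m, smul_comm n, ← smul_add, ← AddCircle.coe_zsmul, ← AddCircle.coe_zsmul,
      ← AddCircle.coe_add, zsmul_eq_mul, zsmul_eq_mul, hk, coe_intCast_eq_zero, smul_zero]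
  have hall : ∀ p : TorusTwo, m • p.1 + n • p.2 = 0 := fun p => closure_minimal hsub hcl (hd p)
  have hhalf : ((1 / 2 : ℝ) : UnitAddCircle) ≠ 0 := by
    intro h0
    have := AddCircle.norm_half_period_eq (1 : ℝ)
    rw [h0] at this
    norm_num at this
  have hm : m = 0 := by
    by_contra hm
    obtain ⟨d, hd⟩ := zsmul_surjective hm ((1 / 2 : ℝ) : UnitAddCircle)
    have := hall (d, 0)
    simp only [smul_zero, add_zero, hd] at this
    exact hhalf this
  have hn : n = 0 := by
    by_contra hn
    obtain ⟨d, hd⟩ := zsmul_surjective hn ((1 / 2 : ℝ) : UnitAddCircle)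
    have := hall (0, d)
    simp only [smul_zero, zero_add, hd] at this
    exact hhalf this
  subst hm hn
  have hk0 : k = 0 := by
    have : (k : ℝ) = 0 := by rw [← hk]; simp
    exact_mod_cast this
  subst hk0
  simp at hgcd

theorem RationallyRelated.symm {x y : ℝ} (h : RationallyRelated x y) : RationallyRelated y x := by
  obtain ⟨m, n, k, hgcd, hk⟩ := h
  exact ⟨n, m, k, by rwa [Int.gcd_comm n m], by rw [add_comm, hk]⟩

theorem irrational_of_not_rationallyRelated {x y : ℝ} (h : ¬ RationallyRelated x y) :
    Irrational x := by
  rintro ⟨r, rfl⟩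
  refine h ⟨r.den, 0, r.num, ?_, ?_⟩
  · rw [Int.gcd_zero_right, Int.natAbs_natCast, Int.gcd_comm]
    exact r.reduced
  · have : (r.den : ℝ) * r = (r.num : ℝ) := by exact_mod_cast Rat.den_mul_eq_num r
    simpa using this

theorem mainTheorem1 (x y : ℝ) :
    (Irrational x ∧ Irrational y ∧ ¬ RationallyRelated x y) ↔
      Dense (orbit235 (torusPoint x y)) := by
  constructor
  · rintro ⟨-, -, h⟩
    exact dense_orbit235_of_isIndependent (isIndependent_of_not_rationallyRelated h)
  · intro hd
    have h : ¬ RationallyRelated x y := fun h => not_dense_of_rationallyRelated h hd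
    exact ⟨irrational_of_not_rationallyRelated h,
      irrational_of_not_rationallyRelated fun h' => h h'.symm, h⟩
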